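/- All graphs are finite, simple and undirected. A graph $G$ is *distance-hereditary* if in every connected induced subgraph of $G$ the distances are the same as in $G$. A *clique cycle-transversal* (cct) of $G$ is a clique $T\subseteq V(G)$ (possibly empty) with $T\cap V(C)\neq\emptyset$ for every cycle $C$ of $G$. Let $G_1,\dots,G_{12}$ be the following graphs, where $K_n$, $C_n$, $I_n$ are the complete graph, the cycle and the edgeless graph on $n$ vertices, $\cup$ is disjoint union and $+$ is join: - $G_1=K_3\cup K_3$, $G_2=K_3\cup C_4$, $G_3=C_4\cup C_4$; - $G_4=K_{3,3}$, $G_5=(K_2\cup K_2)+I_2$, $G_6=C_4+I_2$ (the octahedron); - $G_7$ (respectively $G_8$): take vertices $x,y,a,b,u$ with edges $xy,xa,xb,ya,yb,ua,ub$, and a triangle (respectively a $C_4$) that contains $u$ and whose other vertices are new and have no further neighbours; - $G_9$ (respectively $G_{10}$): take vertices $x,y,a,b,d,c$ with edges $xa,xb,xd,ya,yb,yd,ca,cb$, and a triangle (respectively a $C_4$) that contains $d$ and whose other vertices are new and have no further neighbours; - $G_{11}$: vertices $x,y,a,b,c,u,v$ with edges $xa,xb,xc,ya,yb,yc,ua,ub,va,vb,uv$;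 - $G_{12}$: vertices $x,y,a,b,c,u,v,w$ with edges $xa,xb,xc,ya,yb,yc,ua,ub,va,vb,wu,wv$. **Theorem.** Let $G$ be a distance-hereditary graph. Then $G$ admits a clique cycle-transversal (equivalently, $V(G)$ can be partitioned into a clique and a set inducing a forest, either of which may be empty) if and only if $G$ contains none of $G_1,\dots,G_{12}$ as an induced subgraph. -/

import Mathlib

namespace CliqueCycleTransversal

/-- A graph is distance-hereditary if distances in each of its connected induced subgraphs
are the same as in the whole graph. -/
def IsDistanceHereditary {V : Type*} (G : SimpleGraph V) : Prop :=
  ∀ S : Set V, (G.induce S).Connected →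
    ∀ u v : S, (G.induce S).dist u v = G.dist (u : V) (v : V)

/-- A set `T` of vertices is a cycle-transversal if it meets the vertex set of every cycle
(chordless or not) of the graph. -/
def IsCycleTransversal {V : Type*} (G : SimpleGraph V) (T : Set V) : Prop :=
  ∀ (v : V) (c : G.Walk v v), c.IsCycle → ∃ w ∈ c.support, w ∈ T

/-- The graph has a cycle-transversal that is a clique (the empty clique is allowed). -/
def AdmitsCCT {V : Type*} (G : SimpleGraph V) : Prop :=
  ∃ T : Set V, G.IsClique T ∧ IsCycleTransversal G T

/-- The vertex set splits into a clique and a set inducing a forest. -/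
def SplitsIntoCliqueAndForest {V : Type*} (G : SimpleGraph V) : Prop :=
  ∃ Q F : Set V, Q ∪ F = Set.univ ∧ Disjoint Q F ∧ G.IsClique Q ∧ (G.induce F).IsAcyclic

/-- The simple graph on the vertices `0, …, n - 1` whose edges are the pairs in the list. -/
def ofEdges (n : ℕ) (l : List (Fin n × Fin n)) : SimpleGraph (Fin n) :=
  SimpleGraph.fromRel fun u v => (u, v) ∈ l

instance (n : ℕ) (l : List (Fin n × Fin n)) : DecidableRel (ofEdges n l).Adj :=
  fun u v => decidable_of_iff (u ≠ v ∧ ((u, v) ∈ l ∨ (v, u) ∈ l))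
    (SimpleGraph.fromRel_adj (fun u v => (u, v) ∈ l) u v).symm

/-- Two disjoint triangles. -/
abbrev G1 : SimpleGraph (Fin 6) :=
  ofEdges 6 [(0, 1), (0, 2), (1, 2), (3, 4), (3, 5), (4, 5)]

/-- The disjoint union of a triangle and a 4-cycle. -/
abbrev G2 : SimpleGraph (Fin 7) :=
  ofEdges 7 [(0, 1), (0, 2), (1, 2), (3, 4), (4, 5), (5, 6), (3, 6)]

/-- Two disjoint 4-cycles. -/
abbrev G3 : SimpleGraph (Fin 8) :=
  ofEdges 8 [(0, 1), (1, 2), (2, 3), (0, 3), (4, 5), (5, 6), (6, 7), (4, 7)]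

/-- The complete bipartite graph with parts `0, 1, 2` and `3, 4, 5`. -/
abbrev G4 : SimpleGraph (Fin 6) :=
  ofEdges 6 [(0, 3), (0, 4), (0, 5), (1, 3), (1, 4), (1, 5), (2, 3), (2, 4), (2, 5)]

/-- The join of two disjoint edges `01`, `45` and two nonadjacent vertices `2`, `3`. -/
abbrev G5 : SimpleGraph (Fin 6) :=
  ofEdges 6 [(0, 1), (4, 5), (0, 2), (0, 3), (1, 2), (1, 3), (4, 2), (4, 3), (5, 2), (5, 3)]

/-- The octahedron: the join of the 4-cycle `2345` and two nonadjacent vertices `0`, `1`. -/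
abbrev G6 : SimpleGraph (Fin 6) :=
  ofEdges 6 [(2, 3), (3, 4), (4, 5), (2, 5),
    (0, 2), (0, 3), (0, 4), (0, 5), (1, 2), (1, 3), (1, 4), (1, 5)]

/-- The diamond on `0, 1, 2, 3` (without the edge `23`), a vertex `4` adjacent to `2` and `3`,
and a triangle `456`. -/
abbrev G7 : SimpleGraph (Fin 7) :=
  ofEdges 7 [(0, 1), (0, 2), (0, 3), (1, 2), (1, 3), (2, 4), (3, 4), (4, 5), (4, 6), (5, 6)]

/-- The diamond on `0, 1, 2, 3` (without the edge `23`), a vertex `4` adjacent to `2` and `3`,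
and a 4-cycle `4567`. -/
abbrev G8 : SimpleGraph (Fin 8) :=
  ofEdges 8 [(0, 1), (0, 2), (0, 3), (1, 2), (1, 3), (2, 4), (3, 4),
    (4, 5), (5, 6), (6, 7), (4, 7)]

/-- The complete bipartite graph with parts `0, 1` and `2, 3, 4`, a vertex `5` adjacent to `2`
and `3`, and a triangle `467`. -/
abbrev G9 : SimpleGraph (Fin 8) :=
  ofEdges 8 [(0, 2), (0, 3), (0, 4), (1, 2), (1, 3), (1, 4), (2, 5), (3, 5),
    (4, 6), (4, 7), (6, 7)]

/-- The complete bipartite graph with parts `0, 1` and `2, 3, 4`, a vertex `5` adjacent to `2`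
and `3`, and a 4-cycle `4678`. -/
abbrev G10 : SimpleGraph (Fin 9) :=
  ofEdges 9 [(0, 2), (0, 3), (0, 4), (1, 2), (1, 3), (1, 4), (2, 5), (3, 5),
    (4, 6), (6, 7), (7, 8), (4, 8)]

/-- The complete bipartite graph with parts `0, 1` and `2, 3, 4`, and two adjacent vertices
`5`, `6`, both adjacent to `2` and `3`. -/
abbrev G11 : SimpleGraph (Fin 7) :=
  ofEdges 7 [(0, 2), (0, 3), (0, 4), (1, 2), (1, 3), (1, 4), (2, 5), (3, 5), (2, 6), (3, 6),
    (5, 6)]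

/-- The complete bipartite graph with parts `0, 1` and `2, 3, 4`, two nonadjacent vertices
`5`, `6`, both adjacent to `2` and `3`, and a vertex `7` adjacent to `5` and `6`. -/
abbrev G12 : SimpleGraph (Fin 8) :=
  ofEdges 8 [(0, 2), (0, 3), (0, 4), (1, 2), (1, 3), (1, 4), (2, 5), (3, 5), (2, 6), (3, 6),
    (5, 7), (6, 7)]

/-- None of the twelve graphs is (isomorphic to) an induced subgraph of `G`. -/
def IsForbiddenFree {V : Type*} (G : SimpleGraph V) : Prop :=
  ¬ G1.IsIndContained G ∧ ¬ G2.IsIndContained G ∧ ¬ G3.IsIndContained G ∧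
  ¬ G4.IsIndContained G ∧ ¬ G5.IsIndContained G ∧ ¬ G6.IsIndContained G ∧
  ¬ G7.IsIndContained G ∧ ¬ G8.IsIndContained G ∧ ¬ G9.IsIndContained G ∧
  ¬ G10.IsIndContained G ∧ ¬ G11.IsIndContained G ∧ ¬ G12.IsIndContained G

end CliqueCycleTransversal

namespace CliqueCycleTransversal

/-! In a finite distance-hereditary graph every cycle has a triangle or a 4-cycle on its vertices.
Hence a clique is a cycle-transversal exactly when its removal leaves a thin set, that is, one
without triangles and 4-cycles (`IsDistanceHereditary.admitsCCT_iff`). This property, `HasCCT`,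
passes to induced subgraphs, and each of the twelve graphs fails it by a finite check.

For the converse, take an inclusion-minimal set U without such a clique. A connected
distance-hereditary graph with at least two vertices has a pendant vertex or two twins, so U is
built from single marked vertices by disjoint unions and by complete joins between marked subsets
(`IsComposed`). The marked vertices are the only ones through which a piece still communicates with
the rest of U: a vertex outside the piece sees either exactly its marked vertices or none of it.
Thus each piece A with marks S is one side of a join whose other side is U \ A (`IsJoin`).

The core is that in a minimal bad set at least one side of such a join is `IsSimple`. If no marked
clique makes one side thin, minimality shrinks the other side to a vertex, a pair, a cherry or a
short cycle. If both sides can be made thin and one of them with at most one mark left over,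
minimality shrinks that side to a nonadjacent pair. Otherwise both marked sets contain three
pairwise nonadjacent vertices, and these form the complete bipartite graph `G4`.

Now climb the composition. Single vertices are simple. If two simple pieces combine to a piece that
is not simple, then the rest of U is simple, so U consists of three simple sets joined in a star or
a triangle. There a transversal can be assembled, since every obstruction contains one of the
forbidden graphs (`IsJoin.hasCCT_star`, `IsJoin.hasCCT_triangle`); this contradicts the choice of U.
So U itself is simple, and a simple set has a transversal: the final contradiction. -/

open SimpleGraph

variable {V : Type*} {G : SimpleGraph V}

/-! ### Common neighbours and induced paths -/

/-- In a distance-hereditary graph, two nonadjacent vertices with a common neighbour have a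
common neighbour on every walk between them. -/
theorem IsDistanceHereditary.exists_mem_support (hG : IsDistanceHereditary G) {a b c : V}
    (p : G.Walk a b) (hne : a ≠ b) (hab : ¬ G.Adj a b) (hac : G.Adj a c) (hcb : G.Adj c b) :
    ∃ w ∈ p.support, G.Adj a w ∧ G.Adj w b := by
  -- The support induces a connected subgraph, so the distance of the ends, at most 2 in the whole
  -- graph, is already realized inside the support.
  have hc := p.connected_induce_support
  have hd := hG _ hc ⟨a, p.start_mem_support⟩ ⟨b, p.end_mem_support⟩
  have hle : G.dist a b ≤ 2 := dist_le (Walk.cons hac (Walk.cons hcb Walk.nil))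
  obtain ⟨q, hq⟩ := hc.exists_walk_length_eq_dist ⟨a, p.start_mem_support⟩
    ⟨b, p.end_mem_support⟩
  rw [hd] at hq
  simp only at hq
  match q, hq with
  | .nil, _ => exact absurd rfl hne
  | .cons h .nil, _ => exact absurd h hab
  | .cons (v := w) h (.cons h' .nil), _ => exact ⟨w.1, w.2, h, h'⟩
  | .cons _ (.cons _ (.cons _ _)), hq =>
    simp only [Walk.length_cons] at hq
    omega

/-- The ends of an induced path on four vertices have no common neighbour. -/
theorem IsDistanceHereditary.no_path_four (hG : IsDistanceHereditary G) {a b c d e : V}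
    (hab : G.Adj a b) (hbc : G.Adj b c) (hcd : G.Adj c d) (hac : ¬ G.Adj a c)
    (had : ¬ G.Adj a d) (hbd : ¬ G.Adj b d) (hae : G.Adj a e) (hed : G.Adj e d) : False := by
  have hne : a ≠ d := by rintro rfl; exact hac hcd.symm
  obtain ⟨w, hw, h1, h2⟩ := hG.exists_mem_support
    (Walk.cons hab (Walk.cons hbc (Walk.cons hcd Walk.nil))) hne had hae hed
  simp only [Walk.support_cons, Walk.support_nil, List.mem_cons, List.not_mem_nil,
    or_false] at hw
  rcases hw with rfl | rfl | rfl | rfl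
  · exact had h2
  · exact hbd h2
  · exact hac h1
  · exact had h1

/-- The ends of an induced path on five vertices have no common neighbour. -/
theorem IsDistanceHereditary.no_path_five (hG : IsDistanceHereditary G) {a b c d e f : V}
    (hab : G.Adj a b) (hbc : G.Adj b c) (hcd : G.Adj c d) (hde : G.Adj d e)
    (hac : ¬ G.Adj a c) (had : ¬ G.Adj a d) (hae : ¬ G.Adj a e) (hbe : ¬ G.Adj b e)
    (hne : a ≠ e) (haf : G.Adj a f) (hfe : G.Adj f e) : False := by
  obtain ⟨w, hw, h1, h2⟩ := hG.exists_mem_support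
    (Walk.cons hab (Walk.cons hbc (Walk.cons hcd (Walk.cons hde Walk.nil)))) hne hae haf hfe
  simp only [Walk.support_cons, Walk.support_nil, List.mem_cons, List.not_mem_nil,
    or_false] at hw
  rcases hw with rfl | rfl | rfl | rfl | rfl
  · exact hae h2
  · exact hbe h2
  · exact hac h1
  · exact had h1
  · exact hae h1

/-- Distance-heredity passes to induced subgraphs. -/
theorem IsDistanceHereditary.induce (hG : IsDistanceHereditary G) (U : Set V) :
    IsDistanceHereditary (G.induce U) := by
  intro S hS u v
  let f : (G.induce U).induce S ↪g G :=
    (Embedding.induce (G := G.induce U) S).trans (Embedding.induce U)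
  have hrange : ∀ x : S, f x ∈ (Subtype.val '' S : Set V) := fun x => ⟨x.1, x.2, rfl⟩
  have hconn : (G.induce (Subtype.val '' S)).Connected := by
    let g : (G.induce U).induce S →g G.induce (Subtype.val '' S) :=
      ⟨fun x => ⟨x.1.1, hrange x⟩, fun h => h⟩
    refine hS.map g ?_
    rintro ⟨_, x, hx, rfl⟩
    exact ⟨⟨x, hx⟩, rfl⟩
  have key := hG _ hconn ⟨u.1.1, hrange u⟩ ⟨v.1.1, hrange v⟩
  have hreach : ((G.induce U).induce S).Reachable u v := hS u v
  -- Passing to a subgraph can only increase distances, so the distance in `G.induce U` lies between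
  -- those in `G` and in the subgraph induced by `S`; the latter two agree by hypothesis.
  have h1 : (G.induce U).dist u.1 v.1 ≤ ((G.induce U).induce S).dist u v := by
    obtain ⟨p, hp⟩ := hreach.exists_walk_length_eq_dist
    rw [← hp, ← Walk.length_map (Embedding.induce S).toHom p]
    exact dist_le _
  have hreach' : (G.induce U).Reachable u.1 v.1 := hreach.map (Embedding.induce S).toHom
  have h2 : G.dist u.1.1 v.1.1 ≤ (G.induce U).dist u.1 v.1 := by
    obtain ⟨p, hp⟩ := hreach'.exists_walk_length_eq_dist
    rw [← hp, ← Walk.length_map (Embedding.induce U).toHom p]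
    exact dist_le _
  have h3 : ((G.induce U).induce S).dist u v
      ≤ (G.induce (Subtype.val '' S)).dist ⟨u.1.1, hrange u⟩ ⟨v.1.1, hrange v⟩ := by
    obtain ⟨p, hp⟩ := (hconn ⟨u.1.1, hrange u⟩ ⟨v.1.1, hrange v⟩).exists_walk_length_eq_dist
    have hU : ∀ x : (Subtype.val '' S : Set V), x.1 ∈ U := by
      rintro ⟨_, x, hx, rfl⟩; exact x.2
    have hmem : ∀ x : (Subtype.val '' S : Set V), (⟨x.1, hU x⟩ : U) ∈ S := by
      rintro ⟨_, x, hx, rfl⟩; exact hx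
    let g : G.induce (Subtype.val '' S) →g (G.induce U).induce S :=
      ⟨fun x => ⟨⟨x.1, hU x⟩, hmem x⟩, fun h => h⟩
    rw [← hp, ← Walk.length_map g p]
    exact dist_le _
  simp only at key
  omega

/-! ### Levels of a connected distance-hereditary graph -/

theorem exists_adj_dist_add_one (hc : G.Connected) (r v : V) (h : r ≠ v) :
    ∃ u, G.Adj u v ∧ G.dist r u + 1 = G.dist r v := by
  obtain ⟨p, hp⟩ := hc.exists_walk_length_eq_dist v r
  match p, hp with
  | .nil, _ => exact absurd rfl h
  | .cons (v := u) hvu q, hp =>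
    refine ⟨u, hvu.symm, ?_⟩
    have h1 : G.dist u r ≤ q.length := dist_le q
    have h2 : G.dist r v ≤ G.dist r u + 1 := by
      have := hc.dist_triangle (u := r) (v := u) (w := v)
      rwa [dist_eq_one_iff_adj.2 hvu.symm] at this
    simp only [Walk.length_cons] at hp
    rw [dist_comm (u := r) (v := u), dist_comm (u := r) (v := v)] at *
    omega

theorem dist_le_add_one (hc : G.Connected) (r : V) {u v : V} (h : G.Adj u v) :
    G.dist r v ≤ G.dist r u + 1 := by
  have := hc.dist_triangle (u := r) (v := u) (w := v)
  rwa [dist_eq_one_iff_adj.2 h] at this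

/-- Every vertex is joined to the root by a walk whose other vertices lie on smaller levels. -/
theorem exists_walk_descending (hc : G.Connected) (r v : V) :
    ∃ p : G.Walk v r, ∀ w ∈ p.support, w = v ∨ G.dist r w < G.dist r v := by
  induction hn : G.dist r v generalizing v with
  | zero =>
    have := (hc.dist_eq_zero_iff (u := r) (v := v)).1 hn
    subst this
    exact ⟨Walk.nil, by simp⟩
  | succ n ih =>
    have hne : r ≠ v := by rintro rfl; simp at hn
    obtain ⟨u, huv, hu⟩ := exists_adj_dist_add_one hc r v hne
    obtain ⟨p, hp⟩ := ih u (by omega)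
    refine ⟨Walk.cons huv.symm p, ?_⟩
    intro w hw
    rw [Walk.support_cons, List.mem_cons] at hw
    rcases hw with rfl | hw
    · exact Or.inl rfl
    · rcases hp w hw with rfl | h
      · exact Or.inr (by omega)
      · exact Or.inr (by omega)

/-- Two vertices are joined by a walk whose inner vertices lie on smaller levels. -/
theorem exists_walk_through_root (hc : G.Connected) (r x y : V) :
    ∃ p : G.Walk x y, ∀ w ∈ p.support,
      w = x ∨ w = y ∨ G.dist r w < G.dist r x ∨ G.dist r w < G.dist r y := by
  obtain ⟨p, hp⟩ := exists_walk_descending hc r x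
  obtain ⟨q, hq⟩ := exists_walk_descending hc r y
  refine ⟨p.append q.reverse, fun w hw => ?_⟩
  rw [Walk.mem_support_append_iff, Walk.support_reverse, List.mem_reverse] at hw
  rcases hw with h | h
  · rcases hp w h with h | h <;> tauto
  · rcases hq w h with h | h <;> tauto

/-- Adjacent vertices of the same level have the same neighbours on the previous level. -/
theorem IsDistanceHereditary.adj_parent_of_adj (hG : IsDistanceHereditary G)
    (hc : G.Connected) (r : V) {x y z : V} (hxy : G.Adj x y) (hd : G.dist r x = G.dist r y)
    (hzx : G.Adj z x) (hz : G.dist r z + 1 = G.dist r x) : G.Adj z y := by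
  induction hn : G.dist r x using Nat.strong_induction_on generalizing x y z with
  | _ n ih =>
    by_contra hzy
    have hzne : z ≠ y := by rintro rfl; omega
    -- The common neighbour `w` found on a walk through the root is forced onto the level of `z`. A
    -- parent `u` of `z` is by induction also adjacent to `w`, and then `w` joins the ends of the
    -- induced path u z x y.
    obtain ⟨p, hp⟩ := exists_walk_through_root hc r z y
    obtain ⟨w, hw, hzw, hwy⟩ := hG.exists_mem_support p hzne hzy hzx hxy
    have hw1 := dist_le_add_one hc r hwy
    have hwd : G.dist r w + 1 = G.dist r y := by
      rcases hp w hw with rfl | rfl | h | h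
      · exact absurd hzw (G.irrefl)
      · exact absurd hwy (G.irrefl)
      · omega
      · omega
    have hrz : r ≠ z := by
      rintro rfl
      have h0 : G.dist r w = 0 := by simp at hz; omega
      rw [hc.dist_eq_zero_iff] at h0
      exact G.irrefl (h0 ▸ hzw)
    obtain ⟨u, huz, hu⟩ := exists_adj_dist_add_one hc r z hrz
    have huw : G.Adj u w := ih (G.dist r z) (by omega) hzw (by omega) huz hu rfl
    have hux : ¬ G.Adj u x := fun h => by have := dist_le_add_one hc r h; omega
    have huy : ¬ G.Adj u y := fun h => by have := dist_le_add_one hc r h; omega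
    by_cases hwx : G.Adj w x
    · exact hG.no_path_four huz hzx hxy hux huy hzy huw hwy
    · exact hG.no_path_four huw hwy hxy.symm huy hux hwx huz hzx

/-- Vertices of the same level with a common child have the same neighbours on the previous
level. -/
theorem IsDistanceHereditary.adj_parent_of_child (hG : IsDistanceHereditary G)
    (hc : G.Connected) (r : V) {v x y z : V} (hxv : G.Adj x v) (hyv : G.Adj y v)
    (hx : G.dist r x + 1 = G.dist r v) (hy : G.dist r y + 1 = G.dist r v)
    (hzx : G.Adj z x) (hz : G.dist r z + 1 = G.dist r x) : G.Adj z y := by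
  induction hn : G.dist r v using Nat.strong_induction_on generalizing v x y z with
  | _ n ih =>
    by_contra hzy
    have hxy : ¬ G.Adj x y := fun h => hzy (hG.adj_parent_of_adj hc r h (by omega) hzx hz)
    have hne : x ≠ y := by rintro rfl; exact hzy hzx
    -- Again `w` is forced onto the level of `z`. Now `z` and `w` have the common child `x`, so by
    -- induction they share the parent `u`, and u z x v y is a path whose ends have the common
    -- neighbour `w`.
    obtain ⟨p, hp⟩ := exists_walk_through_root hc r x y
    obtain ⟨w, hw, hxw, hwy⟩ := hG.exists_mem_support p hne hxy hxv hyv.symm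
    have hw1 := dist_le_add_one hc r hwy
    have hwd : G.dist r w + 1 = G.dist r x := by
      rcases hp w hw with rfl | rfl | h | h
      · exact absurd hxw (G.irrefl)
      · exact absurd hwy (G.irrefl)
      · omega
      · omega
    have hrz : r ≠ z := by
      rintro rfl
      have h0 : G.dist r w = 0 := by simp at hz; omega
      rw [hc.dist_eq_zero_iff] at h0
      exact hzy (h0 ▸ hwy)
    obtain ⟨u, huz, hu⟩ := exists_adj_dist_add_one hc r z hrz
    have huw : G.Adj u w := ih (G.dist r x) (by omega) hzx hxw.symm hz hwd huz hu rfl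
    have hux : ¬ G.Adj u x := fun h => by have := dist_le_add_one hc r h; omega
    have huy : ¬ G.Adj u y := fun h => by have := dist_le_add_one hc r h; omega
    have huv : ¬ G.Adj u v := fun h => by have := dist_le_add_one hc r h; omega
    have hzv : ¬ G.Adj z v := fun h => by have := dist_le_add_one hc r h; omega
    have huy' : u ≠ y := by rintro rfl; omega
    exact hG.no_path_five huz hzx hxv hyv.symm hux huv huy hzy huy' huw hwy

/-! ### Twins in sets without induced paths on four vertices -/

/-- No four vertices of the set induce a path. -/
def IsPathFourFree (G : SimpleGraph V) (M : Set V) : Prop :=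
  ∀ a ∈ M, ∀ b ∈ M, ∀ c ∈ M, ∀ d ∈ M, G.Adj a b → G.Adj b c → G.Adj c d → ¬ G.Adj a c →
    ¬ G.Adj b d → a ≠ d → G.Adj a d

theorem IsPathFourFree.mono {M N : Set V} (h : IsPathFourFree G N) (hMN : M ⊆ N) :
    IsPathFourFree G M :=
  fun a ha b hb c hc d hd => h a (hMN ha) b (hMN hb) c (hMN hc) d (hMN hd)

/-- The path on four vertices is self-complementary: a b c d in the complement is b d a c in the
graph. -/
theorem IsPathFourFree.compl {M : Set V} (h : IsPathFourFree G M) : IsPathFourFree Gᶜ M := by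
  intro a ha b hb c hc d hd hab hbc hcd hac hbd hne
  rw [compl_adj] at *
  refine ⟨hne, fun had => ?_⟩
  have hac' : G.Adj a c := by by_contra h'; exact hac ⟨by rintro rfl; exact hcd.2 had, h'⟩
  have hbd' : G.Adj b d := by by_contra h'; exact hbd ⟨by rintro rfl; exact hab.2 had, h'⟩
  exact hbc.2 (h b hb d hd a ha c hc hbd' had.symm hac' (fun h' => hab.2 h'.symm)
    (fun h' => hcd.2 h'.symm) hbc.1)

theorem IsDistanceHereditary.isPathFourFree (hG : IsDistanceHereditary G) {M : Set V} {p : V}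
    (hp : ∀ x ∈ M, G.Adj p x) : IsPathFourFree G M := by
  intro a ha b hb c hc d hd hab hbc hcd hac hbd _
  by_contra had
  exact hG.no_path_four hab hbc hcd hac had hbd (hp a ha).symm (hp d hd)

/-- The set splits into two nonempty parts that are completely adjacent or completely
nonadjacent. -/
def HasHomogeneousSplit (G : SimpleGraph V) (M : Set V) : Prop :=
  ∃ X Y : Set V, X.Nonempty ∧ Y.Nonempty ∧ Disjoint X Y ∧ X ∪ Y = M ∧
    ((∀ x ∈ X, ∀ y ∈ Y, ¬ G.Adj x y) ∨ ∀ x ∈ X, ∀ y ∈ Y, G.Adj x y)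

theorem HasHomogeneousSplit.of_compl {M : Set V} (h : HasHomogeneousSplit Gᶜ M) :
    HasHomogeneousSplit G M := by
  obtain ⟨X, Y, hX, hY, hd, hM, h⟩ := h
  refine ⟨X, Y, hX, hY, hd, hM, ?_⟩
  have hne : ∀ x ∈ X, ∀ y ∈ Y, x ≠ y := fun x hx y hy => hd.ne_of_mem hx hy
  rcases h with h | h
  · right
    intro x hx y hy
    by_contra hxy
    exact h x hx y hy ((compl_adj _ _ _).2 ⟨hne x hx y hy, hxy⟩)
  · left
    intro x hx y hy
    exact ((compl_adj _ _ _).1 (h x hx y hy)).2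

/-- The new vertex is complete to the rest, or misses one part entirely, or has neighbours in both
parts and a nonneighbour in one of them; only the last case needs the absence of induced paths. -/
theorem IsPathFourFree.split_insert {X Y : Set V} {v : V}
    (hP : IsPathFourFree G (insert v (X ∪ Y))) (hX : X.Nonempty) (hY : Y.Nonempty)
    (hd : Disjoint X Y) (hv : v ∉ X ∪ Y) (hXY : ∀ x ∈ X, ∀ y ∈ Y, ¬ G.Adj x y) :
    HasHomogeneousSplit G (insert v (X ∪ Y)) := by
  have hvX : v ∉ X := fun h => hv (Or.inl h)
  have hvY : v ∉ Y := fun h => hv (Or.inr h)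
  by_cases hall : ∀ x ∈ X ∪ Y, G.Adj v x
  · exact ⟨{v}, X ∪ Y, Set.singleton_nonempty v, hX.inl, by simpa using hv, rfl,
      Or.inr (by simpa using hall)⟩
  by_cases h1 : ∃ x ∈ X, G.Adj v x
  swap
  · refine ⟨X, insert v Y, hX, Set.insert_nonempty _ _, ?_, ?_, Or.inl ?_⟩
    · rw [Set.disjoint_insert_right]; exact ⟨hvX, hd⟩
    · rw [Set.union_insert]
    · rintro x hx y (rfl | hy) h
      · exact h1 ⟨x, hx, h.symm⟩
      · exact hXY x hx y hy h
  by_cases h2 : ∃ y ∈ Y, G.Adj v y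
  swap
  · refine ⟨insert v X, Y, Set.insert_nonempty _ _, hY, ?_, ?_, Or.inl ?_⟩
    · rw [Set.disjoint_insert_left]; exact ⟨hvY, hd⟩
    · rw [Set.insert_union]
    · rintro x (rfl | hx) y hy h
      · exact h2 ⟨y, hy, h⟩
      · exact hXY x hx y hy h
  -- The nonneighbours of `v` in X' split off without edges to the rest: an edge from such an x to a
  -- neighbour y of `v` in X' would give the induced path x y v z.
  have key : ∀ X' Y' : Set V, X' ∪ Y' = X ∪ Y → (∀ x ∈ X', ∀ y ∈ Y', ¬ G.Adj x y) →
      (∃ y ∈ Y', G.Adj v y) → (∃ k ∈ X', ¬ G.Adj v k) →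
      HasHomogeneousSplit G (insert v (X ∪ Y)) := by
    rintro X' Y' hU hXY' ⟨z, hz, hvz⟩ ⟨k, hk, hvk⟩
    have hkU : ∀ {x}, x ∈ X' → x ∈ X ∪ Y := fun h => hU ▸ Or.inl h
    have hzU : z ∈ X ∪ Y := hU ▸ Or.inr hz
    refine ⟨{x | x ∈ X' ∧ ¬ G.Adj v x}, insert v (X ∪ Y) \ {x | x ∈ X' ∧ ¬ G.Adj v x},
      ⟨k, hk, hvk⟩, ⟨v, Or.inl rfl, fun h => hv (hkU h.1)⟩, Set.disjoint_sdiff_right, ?_,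
      Or.inl ?_⟩
    · exact Set.union_sdiff_cancel fun x hx => Or.inr (hkU hx.1)
    · rintro x ⟨hx, hvx⟩ y ⟨rfl | hy, hy'⟩ h
      · exact hvx h.symm
      · rw [← hU] at hy
        rcases hy with hy | hy
        · have hvy : G.Adj v y := by by_contra h'; exact hy' ⟨hy, h'⟩
          have hne : x ≠ z := by rintro rfl; exact hvx hvz
          exact hXY' x hx z hz (hP x (Or.inr (hkU hx)) y (Or.inr (hkU hy)) v (Or.inl rfl) z
            (Or.inr hzU) h hvy.symm hvz (fun h' => hvx h'.symm) (hXY' y hy z hz) hne)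
        · exact hXY' x hx y hy h
  push Not at hall
  obtain ⟨k, hk, hvk⟩ := hall
  rcases hk with hk | hk
  · exact key X Y rfl hXY h2 ⟨k, hk, hvk⟩
  · exact key Y X (Set.union_comm _ _) (fun x hx y hy h => hXY y hy x hx h.symm) h1 ⟨k, hk, hvk⟩

/-- Vertices are added one at a time. A split into completely adjacent parts becomes one without
edges in the complement, which is again free of induced paths on four vertices. -/
theorem IsPathFourFree.hasHomogeneousSplit [Finite V] {M : Set V} (hP : IsPathFourFree G M)
    (hM : M.Nontrivial) : HasHomogeneousSplit G M := by
  induction M, M.toFinite using Set.Finite.induction_on with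
  | empty => exact absurd hM Set.not_nontrivial_empty
  | @insert v M' hv _ ih =>
    rcases M'.subsingleton_or_nontrivial with hs | hn
    · rcases hs.eq_empty_or_singleton with rfl | ⟨x, rfl⟩
      · simp at hM
      · refine ⟨{v}, {x}, Set.singleton_nonempty _, Set.singleton_nonempty _, by simpa using hv,
          rfl, ?_⟩
        by_cases h : G.Adj v x
        · right; simpa using h
        · left; simpa using h
    · obtain ⟨X, Y, hX, hY, hd, rfl, h | h⟩ := ih (hP.mono (Set.subset_insert _ _)) hn
      · exact hP.split_insert hX hY hd hv h
      · refine HasHomogeneousSplit.of_compl (hP.compl.split_insert hX hY hd hv ?_)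
        intro x hx y hy hxy
        exact ((compl_adj _ _ _).1 hxy).2 (h x hx y hy)

/-- A finite set of at least two vertices without induced path on four vertices contains
twins. -/
theorem IsPathFourFree.exists_twins [Finite V] {M : Set V} (hP : IsPathFourFree G M)
    (hM : M.Nontrivial) :
    ∃ x ∈ M, ∃ y ∈ M, x ≠ y ∧ ∀ z ∈ M, z ≠ x → z ≠ y → (G.Adj x z ↔ G.Adj y z) := by
  induction hn : M.ncard using Nat.strong_induction_on generalizing M with
  | _ n ih =>
    obtain ⟨X, Y, hX, hY, hd, rfl, h⟩ := hP.hasHomogeneousSplit hM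
    have hcard := Set.ncard_union_eq hd
    have hXp := (Set.ncard_pos).2 hX
    have hYp := (Set.ncard_pos).2 hY
    -- Twins inside one part remain twins, because the other part is uniform to them. If both parts
    -- are single vertices, these two are twins.
    rcases X.subsingleton_or_nontrivial with hsX | hnX
    · rcases Y.subsingleton_or_nontrivial with hsY | hnY
      · obtain ⟨x, hx⟩ := hX
        obtain ⟨y, hy⟩ := hY
        refine ⟨x, Or.inl hx, y, Or.inr hy, hd.ne_of_mem hx hy, ?_⟩
        rintro z (hz | hz) h1 h2
        · exact absurd (hsX hz hx) h1
        · exact absurd (hsY hz hy) h2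
      · obtain ⟨x, hx, y, hy, hne, hxy⟩ :=
          ih _ (by omega) (hP.mono Set.subset_union_right) hnY rfl
        refine ⟨x, Or.inr hx, y, Or.inr hy, hne, ?_⟩
        rintro z (hz | hz) h1 h2
        · rcases h with h | h
          · exact iff_of_false (fun h' => h z hz x hx h'.symm) (fun h' => h z hz y hy h'.symm)
          · exact iff_of_true (h z hz x hx).symm (h z hz y hy).symm
        · exact hxy z hz h1 h2
    · obtain ⟨x, hx, y, hy, hne, hxy⟩ :=
        ih _ (by omega) (hP.mono Set.subset_union_left) hnX rfl
      refine ⟨x, Or.inl hx, y, Or.inl hy, hne, ?_⟩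
      rintro z (hz | hz) h1 h2
      · exact hxy z hz h1 h2
      · rcases h with h | h
        · exact iff_of_false (h x hx z hz) (h y hy z hz)
        · exact iff_of_true (h x hx z hz) (h y hy z hz)

/-- A module that induces no path on four vertices contains twins of the whole graph. -/
theorem exists_twins_of_module [Finite V] {M : Set V} (hP : IsPathFourFree G M)
    (hM : M.Nontrivial)
    (hmod : ∀ w ∉ M, ∀ x ∈ M, ∀ y ∈ M, G.Adj w x → G.Adj w y) :
    ∃ x y, x ≠ y ∧ ∀ z, z ≠ x → z ≠ y → (G.Adj x z ↔ G.Adj y z) := by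
  obtain ⟨x, hx, y, hy, hne, h⟩ := hP.exists_twins hM
  refine ⟨x, y, hne, fun z hzx hzy => ?_⟩
  by_cases hz : z ∈ M
  · exact h z hz hzx hzy
  · exact ⟨fun h' => (hmod z hz x hx y hy h'.symm).symm,
      fun h' => (hmod z hz y hy x hx h'.symm).symm⟩

/-! ### Existence of a pendant vertex or of twins -/

/-- Distinct vertices `x`, `y` such that `x` is pendant at `y`, or `x` and `y` are twins. -/
def IsPendantOrTwin (G : SimpleGraph V) (x y : V) : Prop :=
  x ≠ y ∧ ((∀ z, G.Adj x z → z = y) ∨ ∀ z, z ≠ x → z ≠ y → (G.Adj x z ↔ G.Adj y z))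

/-- If `v` lies on the last level and `y`, `w` are adjacent vertices on the level before it with
`y` adjacent to `v` and `w` not, then `w` is adjacent to all the neighbours of `v` on that
level. -/
theorem IsDistanceHereditary.adj_of_child (hG : IsDistanceHereditary G) (hc : G.Connected)
    (r : V) {v w x y : V} (hxv : G.Adj x v) (hyv : G.Adj y v) (hwv : ¬ G.Adj w v)
    (hx : G.dist r x + 1 = G.dist r v) (hy : G.dist r y + 1 = G.dist r v)
    (hw : G.dist r w + 1 = G.dist r v) (hwx : G.Adj w x) : G.Adj w y := by
  by_contra hwy
  have hrx : r ≠ x := by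
    rintro rfl
    have h0 : G.dist r w = 0 := by simp at hx; omega
    rw [hc.dist_eq_zero_iff] at h0
    exact G.irrefl (h0 ▸ hwx)
  obtain ⟨p, hpx, hp⟩ := exists_adj_dist_add_one hc r x hrx
  have hpw : G.Adj p w := hG.adj_parent_of_adj hc r hwx.symm (by omega) hpx hp
  have hpy : G.Adj p y := hG.adj_parent_of_child hc r hxv hyv hx hy hpx hp
  have hpv : ¬ G.Adj p v := fun h => by have := dist_le_add_one hc r h; omega
  by_cases hxy : G.Adj x y
  · exact hG.no_path_four hpw.symm hpy hyv hwy hwv hpv hwx hxv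
  · exact hG.no_path_four hwx hxv hyv.symm hwv hwy hxy hpw.symm hpy

/-- A connected distance-hereditary graph with at least two vertices has a pendant vertex or
two twins. -/
theorem IsDistanceHereditary.exists_pendant_or_twins [Finite V] [Nontrivial V]
    (hG : IsDistanceHereditary G) (hc : G.Connected) : ∃ x y, IsPendantOrTwin G x y := by
  obtain ⟨r⟩ := hc.nonempty
  obtain ⟨v₀, hv₀⟩ := Finite.exists_max (G.dist r)
  obtain ⟨t, ht⟩ := exists_ne r
  have hpos : 0 < G.dist r v₀ := lt_of_lt_of_le
    (Nat.pos_of_ne_zero fun h => ht ((hc.dist_eq_zero_iff.1 h).symm)) (hv₀ t)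
  set m := G.dist r v₀ with hm
  by_cases htop : ∃ a b, G.dist r a = m ∧ G.dist r b = m ∧ G.Adj a b
  · obtain ⟨a, b, ha, hb, hab⟩ := htop
    -- If the last level has an edge, take a component of that level. Its vertices share all their
    -- parents, so it is a module, and a common parent excludes induced paths on four vertices.
    let R : Set V := {x | Relation.ReflTransGen
      (fun x y => G.Adj x y ∧ G.dist r y = m) a x}
    have hR : ∀ x ∈ R, G.dist r x = m := by
      intro x hx
      rcases Relation.ReflTransGen.cases_tail hx with h | ⟨_, _, h⟩
      · rw [h]; exact ha
      · exact h.2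
    have hpar : ∀ w, G.dist r w + 1 = m → ∀ x ∈ R, (G.Adj w a ↔ G.Adj w x) := by
      intro w hw x hx
      induction hx with
      | refl => rfl
      | @tail y z hy hyz ih =>
        have hyd := hR y hy
        rw [ih]
        exact ⟨fun h => hG.adj_parent_of_adj hc r hyz.1 (by omega) h (by omega),
          fun h => hG.adj_parent_of_adj hc r hyz.1.symm (by omega) h (by omega)⟩
    have hra : r ≠ a := by rintro rfl; simp at ha; omega
    obtain ⟨p, hpa, hp⟩ := exists_adj_dist_add_one hc r a hra
    have hP : IsPathFourFree G R :=
      hG.isPathFourFree (p := p) fun x hx => (hpar p (by omega) x hx).1 hpa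
    have hmod : ∀ w ∉ R, ∀ x ∈ R, ∀ y ∈ R, G.Adj w x → G.Adj w y := by
      intro w hw x hx y hy hwx
      have h1 := dist_le_add_one hc r hwx
      have h2 := hv₀ w
      have h3 := hR x hx
      have h4 : G.dist r w ≠ m := fun h => hw (Relation.ReflTransGen.tail hx ⟨hwx.symm, h⟩)
      have h5 : G.dist r w + 1 = m := by omega
      exact (hpar w h5 y hy).1 ((hpar w h5 x hx).2 hwx)
    obtain ⟨x, y, hne, h⟩ := exists_twins_of_module hP
      ⟨a, Relation.ReflTransGen.refl, b, Relation.ReflTransGen.single ⟨hab, hb⟩, hab.ne⟩ hmod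
    exact ⟨x, y, hne, Or.inr h⟩
  · push Not at htop
    -- The last level is independent. For a vertex `v` on it with fewest neighbours, the
    -- neighbourhood of `v` is a module; it has no induced path on four vertices because `v` sees
    -- all of it.
    obtain ⟨v, hv, hmin⟩ := Set.exists_min_image {v | G.dist r v = m}
      (fun v => (G.neighborSet v).ncard) (Set.toFinite _) ⟨v₀, rfl⟩
    have hv : G.dist r v = m := hv
    have hlev : ∀ u, G.dist r u = m → ∀ x, G.Adj x u → G.dist r x + 1 = m := by
      intro u hu x hx
      have h1 := dist_le_add_one hc r hx
      have h2 := hv₀ x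
      have h3 : G.dist r x ≠ m := fun h => htop x u h hu hx
      omega
    have hrv : r ≠ v := by rintro rfl; simp at hv; omega
    obtain ⟨p, hpv, -⟩ := exists_adj_dist_add_one hc r v hrv
    rcases (G.neighborSet v).subsingleton_or_nontrivial with hs | hn
    · exact ⟨v, p, hpv.ne', Or.inl fun z hz => hs hz hpv.symm⟩
    · have hP : IsPathFourFree G (G.neighborSet v) := hG.isPathFourFree (p := v) fun x hx => hx
      have hmod : ∀ w ∉ G.neighborSet v, ∀ x ∈ G.neighborSet v, ∀ y ∈ G.neighborSet v,
          G.Adj w x → G.Adj w y := by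
        intro w hw x hx y hy hwx
        have hxv : G.Adj x v := Adj.symm hx
        have hyv : G.Adj y v := Adj.symm hy
        have hwv : ¬ G.Adj w v := fun h => hw h.symm
        have hxd := hlev v hv x hxv
        have hyd := hlev v hv y hyv
        have h1 := dist_le_add_one hc r hwx
        have h1' := dist_le_add_one hc r hwx.symm
        have h2 := hv₀ w
        rcases (show G.dist r w + 1 = G.dist r x ∨ G.dist r w + 1 = m ∨ G.dist r w = m by
          omega) with hwd | hwd | hwd
        · exact hG.adj_parent_of_child hc r hxv hyv (by omega) (by omega) hwx hwd
        · exact hG.adj_of_child hc r hxv hyv hwv (by omega) (by omega) (by omega) hwx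
        · by_cases hvw : w = v
          · subst hvw; exact hy
          by_contra hwy
          -- If `w` misses `y`, minimality of the degree of `v` gives `w` a private neighbour `z`.
          -- Then z w x v y is a path, and a parent of `x` is adjacent to both of its ends.
          have hz : ∃ z ∈ G.neighborSet w, z ∉ G.neighborSet v := by
            by_contra hsub
            push Not at hsub
            have hlt : (G.neighborSet w).ncard < (G.neighborSet v).ncard :=
              Set.ncard_lt_ncard ⟨hsub, fun h => hwy (h hy)⟩ (Set.toFinite _)
            exact absurd (hmin w hwd) (not_le.2 hlt)
          obtain ⟨z, hzw, hzv⟩ := hz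
          have hzw : G.Adj z w := Adj.symm hzw
          have hzv : ¬ G.Adj z v := fun h => hzv h.symm
          have hzd := hlev w hwd z hzw
          have hyw : ¬ G.Adj y w := fun h => hwy h.symm
          have hyz : ¬ G.Adj y z := fun h =>
            hG.no_path_four hzw.symm h.symm hyv hwy (fun h' => by
              have := htop w v hwd hv; exact this h') hzv hwx hxv
          have hxz : ¬ G.Adj z x := fun h => hyz
            (hG.adj_of_child hc r hxv hyv hzv (by omega) (by omega) (by omega) h).symm
          have hxy : ¬ G.Adj y x := fun h => hyz
            (hG.adj_of_child hc r hwx.symm hzw hyw (by omega) (by omega) (by omega) h)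
          have hwv' : ¬ G.Adj w v := htop w v hwd hv
          have hrx : r ≠ x := by
            rintro rfl
            have h0 : G.dist r z = 0 := by simp at hxd; omega
            have h0' : G.dist r y = 0 := by simp at hxd; omega
            rw [hc.dist_eq_zero_iff] at h0 h0'
            exact hzv (h0 ▸ hxv)
          obtain ⟨q, hqx, hq⟩ := exists_adj_dist_add_one hc r x hrx
          have hqy := hG.adj_parent_of_child hc r hxv hyv (by omega) (by omega) hqx hq
          have hqz := hG.adj_parent_of_child hc r hwx.symm hzw (by omega) (by omega) hqx hq
          exact hG.no_path_five hzw hwx hxv hyv.symm hxz hzv (fun h => hyz h.symm) hwy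
            (fun h => hyw (h ▸ hzw)) hqz.symm hqy
      obtain ⟨x, y, hne, h⟩ := exists_twins_of_module hP hn hmod
      exact ⟨x, y, hne, Or.inr h⟩

/-! ### Decomposition by joins of marked sets -/

/-- `IsComposed G A S`: the set `A` with the marked subset `S` arises from single marked vertices
by disjoint unions and by joining the marked vertices of two sets completely; in the latter case
the marked vertices of the second set may lose their mark. -/
inductive IsComposed (G : SimpleGraph V) : Set V → Set V → Prop
  | single (v : V) : IsComposed G {v} {v}
  | union {A S B R : Set V} (hA : IsComposed G A S) (hB : IsComposed G B R)
      (hd : Disjoint A B) (h : ∀ a ∈ A, ∀ b ∈ B, ¬ G.Adj a b) : IsComposed G (A ∪ B) (S ∪ R)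
  | join {A S B R : Set V} (hA : IsComposed G A S) (hB : IsComposed G B R)
      (hd : Disjoint A B) (h : ∀ a ∈ A, ∀ b ∈ B, G.Adj a b ↔ a ∈ S ∧ b ∈ R) :
      IsComposed G (A ∪ B) (S ∪ R)
  | attach {A S B R : Set V} (hA : IsComposed G A S) (hB : IsComposed G B R)
      (hd : Disjoint A B) (h : ∀ a ∈ A, ∀ b ∈ B, G.Adj a b ↔ a ∈ S ∧ b ∈ R) :
      IsComposed G (A ∪ B) S

theorem IsComposed.subset {A S : Set V} (h : IsComposed G A S) : S ⊆ A := by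
  induction h with
  | single v => exact subset_rfl
  | union _ _ _ _ h1 h2 => exact Set.union_subset_union h1 h2
  | join _ _ _ _ h1 h2 => exact Set.union_subset_union h1 h2
  | attach _ _ _ _ h1 _ => exact h1.trans Set.subset_union_left

/-- The leaf `x` of the composition is replaced by `x` with `v` attached. As `v` loses its mark at
once, no later join affects it and the marks of the whole do not change. -/
theorem IsComposed.insert_pendant {A S : Set V} (h : IsComposed G A S) {x v : V} (hx : x ∈ A)
    (hv : v ∉ A) (hvx : ∀ z ∈ A, G.Adj v z ↔ z = x) : IsComposed G (insert v A) S := by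
  induction h with
  | single u =>
    obtain rfl : x = u := hx
    have := IsComposed.attach (G := G) (.single x) (.single v)
      (by simpa using fun h => hv h.symm) (by simpa using ((hvx x rfl).2 rfl).symm)
    rwa [Set.union_singleton] at this
  | @union A S B R hA hB hd h ihA ihB =>
    have hvA : v ∉ A := fun h => hv (Or.inl h)
    have hvB : v ∉ B := fun h => hv (Or.inr h)
    rcases hx with hx | hx
    · rw [← Set.insert_union]
      refine .union (ihA hx hvA fun z hz => hvx z (Or.inl hz)) hB (by simp [hvB, hd]) ?_
      rintro a (rfl | ha) b hb
      · rw [hvx b (Or.inr hb)]; exact (hd.ne_of_mem hx hb).symm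
      · exact h a ha b hb
    · rw [← Set.union_insert]
      refine .union hA (ihB hx hvB fun z hz => hvx z (Or.inr hz)) (by simp [hvA, hd]) ?_
      rintro a ha b (rfl | hb)
      · rw [G.adj_comm, hvx a (Or.inl ha)]; exact hd.ne_of_mem ha hx
      · exact h a ha b hb
  | @join A S B R hA hB hd h ihA ihB =>
    have hvA : v ∉ A := fun h => hv (Or.inl h)
    have hvB : v ∉ B := fun h => hv (Or.inr h)
    rcases hx with hx | hx
    · rw [← Set.insert_union]
      refine .join (ihA hx hvA fun z hz => hvx z (Or.inl hz)) hB (by simp [hvB, hd]) ?_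
      rintro a (rfl | ha) b hb
      · rw [hvx b (Or.inr hb)]
        exact iff_of_false (hd.ne_of_mem hx hb).symm fun h' => hvA (hA.subset h'.1)
      · exact h a ha b hb
    · rw [← Set.union_insert]
      refine .join hA (ihB hx hvB fun z hz => hvx z (Or.inr hz)) (by simp [hvA, hd]) ?_
      rintro a ha b (rfl | hb)
      · rw [G.adj_comm, hvx a (Or.inl ha)]
        exact iff_of_false (hd.ne_of_mem ha hx) fun h' => hvB (hB.subset h'.2)
      · exact h a ha b hb
  | @attach A S B R hA hB hd h ihA ihB =>
    have hvA : v ∉ A := fun h => hv (Or.inl h)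
    have hvB : v ∉ B := fun h => hv (Or.inr h)
    rcases hx with hx | hx
    · rw [← Set.insert_union]
      refine .attach (ihA hx hvA fun z hz => hvx z (Or.inl hz)) hB (by simp [hvB, hd]) ?_
      rintro a (rfl | ha) b hb
      · rw [hvx b (Or.inr hb)]
        exact iff_of_false (hd.ne_of_mem hx hb).symm fun h' => hvA (hA.subset h'.1)
      · exact h a ha b hb
    · rw [← Set.union_insert]
      refine .attach hA (ihB hx hvB fun z hz => hvx z (Or.inr hz)) (by simp [hvA, hd]) ?_
      rintro a ha b (rfl | hb)
      · rw [G.adj_comm, hvx a (Or.inl ha)]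
        exact iff_of_false (hd.ne_of_mem ha hx) fun h' => hvB (hB.subset h'.2)
      · exact h a ha b hb

/-- The leaf `x` is replaced by the join or the disjoint union of `x` and `v`, according to their
adjacency. From then on `v` shares the fate of `x`, so it is marked at the end exactly if `x` is. -/
theorem IsComposed.insert_twin {A S : Set V} (h : IsComposed G A S) {x v : V} (hx : x ∈ A)
    (hv : v ∉ A) (hvx : ∀ z ∈ A, z ≠ x → (G.Adj v z ↔ G.Adj x z)) :
    IsComposed G (insert v A) (S ∪ {u | u = v ∧ x ∈ S}) := by
  induction h with
  | single u =>
    obtain rfl : x = u := hx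
    have hvx : v ≠ x := hv
    have hset : ({x} ∪ {u | u = v ∧ x ∈ ({x} : Set V)} : Set V) = {x} ∪ {v} := by ext; simp
    rw [hset, ← Set.union_singleton]
    by_cases hadj : G.Adj x v
    · exact .join (.single x) (.single v) (by simpa using hvx.symm) (by simpa using hadj)
    · exact .union (.single x) (.single v) (by simpa using hvx.symm) (by simpa using hadj)
  | @union A S B R hA hB hd h ihA ihB =>
    have hvA : v ∉ A := fun h => hv (Or.inl h)
    have hvB : v ∉ B := fun h => hv (Or.inr h)
    rcases hx with hx | hx
    · have hxR : x ∉ R := fun h => hd.ne_of_mem hx (hB.subset h) rfl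
      have hset : (S ∪ R ∪ {u | u = v ∧ x ∈ S ∪ R}) = (S ∪ {u | u = v ∧ x ∈ S}) ∪ R := by
        ext; simp [hxR]; tauto
      rw [hset, ← Set.insert_union]
      refine .union (ihA hx hvA fun z hz => hvx z (Or.inl hz)) hB (by simp [hvB, hd]) ?_
      rintro a (rfl | ha) b hb
      · rw [hvx b (Or.inr hb) (hd.ne_of_mem hx hb).symm]; exact h x hx b hb
      · exact h a ha b hb
    · have hxS : x ∉ S := fun h => hd.ne_of_mem (hA.subset h) hx rfl
      have hset : (S ∪ R ∪ {u | u = v ∧ x ∈ S ∪ R}) = S ∪ (R ∪ {u | u = v ∧ x ∈ R}) := by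
        ext; simp [hxS]; tauto
      rw [hset, ← Set.union_insert]
      refine .union hA (ihB hx hvB fun z hz => hvx z (Or.inr hz)) (by simp [hvA, hd]) ?_
      rintro a ha b (rfl | hb)
      · rw [G.adj_comm, hvx a (Or.inl ha) (hd.ne_of_mem ha hx), G.adj_comm]; exact h a ha x hx
      · exact h a ha b hb
  | @join A S B R hA hB hd h ihA ihB =>
    have hvA : v ∉ A := fun h => hv (Or.inl h)
    have hvB : v ∉ B := fun h => hv (Or.inr h)
    have hvS : v ∉ S := fun h => hvA (hA.subset h)
    have hvR : v ∉ R := fun h => hvB (hB.subset h)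
    rcases hx with hx | hx
    · have hxR : x ∉ R := fun h => hd.ne_of_mem hx (hB.subset h) rfl
      have hset : (S ∪ R ∪ {u | u = v ∧ x ∈ S ∪ R}) = (S ∪ {u | u = v ∧ x ∈ S}) ∪ R := by
        ext; simp [hxR]; tauto
      rw [hset, ← Set.insert_union]
      refine .join (ihA hx hvA fun z hz => hvx z (Or.inl hz)) hB (by simp [hvB, hd]) ?_
      rintro a (rfl | ha) b hb
      · rw [hvx b (Or.inr hb) (hd.ne_of_mem hx hb).symm, h x hx b hb]; simp [hvS]
      · rw [h a ha b hb]
        have : a ≠ v := by rintro rfl; exact hvA ha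
        simp [this]
    · have hxS : x ∉ S := fun h => hd.ne_of_mem (hA.subset h) hx rfl
      have hset : (S ∪ R ∪ {u | u = v ∧ x ∈ S ∪ R}) = S ∪ (R ∪ {u | u = v ∧ x ∈ R}) := by
        ext; simp [hxS]; tauto
      rw [hset, ← Set.union_insert]
      refine .join hA (ihB hx hvB fun z hz => hvx z (Or.inr hz)) (by simp [hvA, hd]) ?_
      rintro a ha b (rfl | hb)
      · rw [G.adj_comm, hvx a (Or.inl ha) (hd.ne_of_mem ha hx), G.adj_comm, h a ha x hx]
        simp [hvR]
      · rw [h a ha b hb]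
        have : b ≠ v := by rintro rfl; exact hvB hb
        simp [this]
  | @attach A S B R hA hB hd h ihA ihB =>
    have hvA : v ∉ A := fun h => hv (Or.inl h)
    have hvB : v ∉ B := fun h => hv (Or.inr h)
    have hvS : v ∉ S := fun h => hvA (hA.subset h)
    have hvR : v ∉ R := fun h => hvB (hB.subset h)
    rcases hx with hx | hx
    · rw [← Set.insert_union]
      refine .attach (ihA hx hvA fun z hz => hvx z (Or.inl hz)) hB (by simp [hvB, hd]) ?_
      rintro a (rfl | ha) b hb
      · rw [hvx b (Or.inr hb) (hd.ne_of_mem hx hb).symm, h x hx b hb]; simp [hvS]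
      · rw [h a ha b hb]
        have : a ≠ v := by rintro rfl; exact hvA ha
        simp [this]
    · have hxS : x ∉ S := fun h => hd.ne_of_mem (hA.subset h) hx rfl
      have hset : S ∪ {u | u = v ∧ x ∈ S} = S := by ext; simp [hxS]
      rw [hset, ← Set.union_insert]
      refine .attach hA (ihB hx hvB fun z hz => hvx z (Or.inr hz)) (by simp [hvA, hd]) ?_
      rintro a ha b (rfl | hb)
      · rw [G.adj_comm, hvx a (Or.inl ha) (hd.ne_of_mem ha hx), G.adj_comm, h a ha x hx]
        simp [hvR]
      · rw [h a ha b hb]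
        have : b ≠ v := by rintro rfl; exact hvB hb
        simp [this]

/-- Every nonempty vertex set of a distance-hereditary graph can be composed. -/
theorem IsDistanceHereditary.exists_isComposed [Finite V] (hG : IsDistanceHereditary G)
    {U : Set V} (hU : U.Nonempty) : ∃ S, IsComposed G U S := by
  induction hn : U.ncard using Nat.strong_induction_on generalizing U with
  | _ n ih =>
    rcases U.subsingleton_or_nontrivial with hs | hnt
    · obtain ⟨u, rfl⟩ := hs.eq_empty_or_singleton.resolve_left hU.ne_empty
      exact ⟨_, .single u⟩
    have hnt' := hnt.coe_sort
    by_cases hc : (G.induce U).Connected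
    · obtain ⟨x, y, hne, h⟩ := (hG.induce U).exists_pendant_or_twins hc
      have hne' : y.1 ≠ x.1 := fun h => hne (Subtype.ext h.symm)
      have hyU : y.1 ∈ U \ {x.1} := ⟨y.2, hne'⟩
      have hlt : (U \ {x.1}).ncard < n := hn ▸ Set.ncard_sdiff_singleton_lt_of_mem x.2
      obtain ⟨S, hS⟩ := ih _ hlt ⟨y.1, hyU⟩ rfl
      have hins : insert x.1 (U \ {x.1}) = U := Set.insert_sdiff_self_of_mem x.2
      rcases h with h | h
      · have hxy : G.Adj x.1 y.1 := by
          obtain ⟨w, hw⟩ := hc.preconnected.exists_adj_of_nontrivial x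
          have := h w hw
          subst this
          exact hw
        have := hS.insert_pendant hyU (v := x.1) (by simp) fun z hz =>
          ⟨fun hxz => congrArg Subtype.val (h ⟨z, hz.1⟩ hxz), fun hz => hz ▸ hxy⟩
        rw [hins] at this
        exact ⟨_, this⟩
      · have := hS.insert_twin hyU (v := x.1) (by simp) fun z hz hzy =>
          h ⟨z, hz.1⟩ (fun h' => hz.2 (congrArg Subtype.val h'))
            fun h' => hzy (congrArg Subtype.val h')
        rw [hins] at this
        exact ⟨_, this⟩
    · have : ¬ (G.induce U).Preconnected := fun h => hc ⟨h⟩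
      simp only [SimpleGraph.Preconnected, not_forall] at this
      obtain ⟨u, v, huv⟩ := this
      let A : Set V := {x | ∃ h : x ∈ U, (G.induce U).Reachable u ⟨x, h⟩}
      have hAU : A ⊆ U := fun x hx => hx.1
      have huA : u.1 ∈ A := ⟨u.2, Reachable.refl _⟩
      have hvA : v.1 ∉ A := fun h => huv h.2
      have h1 : A.ncard < n := hn ▸ Set.ncard_lt_ncard ⟨hAU, fun h => hvA (h v.2)⟩
      have h2 : (U \ A).ncard < n :=
        hn ▸ Set.ncard_lt_ncard ⟨Set.sdiff_subset, fun h => (h u.2).2 huA⟩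
      obtain ⟨S, hS⟩ := ih _ h1 ⟨u.1, huA⟩ rfl
      obtain ⟨R, hR⟩ := ih _ h2 (U := U \ A) ⟨v.1, v.2, hvA⟩ rfl
      have := IsComposed.union hS hR Set.disjoint_sdiff_right ?_
      · rw [Set.union_sdiff_cancel hAU] at this
        exact ⟨_, this⟩
      · rintro a ⟨ha, hra⟩ b ⟨hb, hb'⟩ hab
        refine hb' ⟨hb, hra.trans (Adj.reachable ?_)⟩
        exact hab

/-! ### Sets without triangles and 4-cycles -/

/-- The set contains no triangle and no 4-cycle (chordless or not). -/
def IsThin (G : SimpleGraph V) (F : Set V) : Prop :=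
  (∀ a ∈ F, ∀ b ∈ F, ∀ c ∈ F, G.Adj a b → G.Adj b c → ¬ G.Adj a c) ∧
  ∀ a ∈ F, ∀ b ∈ F, ∀ c ∈ F, ∀ d ∈ F, a ≠ c → b ≠ d → G.Adj a b → G.Adj b c → G.Adj c d →
    ¬ G.Adj d a

/-- Some clique in `U` meets every triangle and every 4-cycle in `U`. -/
def HasCCT (G : SimpleGraph V) (U : Set V) : Prop :=
  ∃ T ⊆ U, G.IsClique T ∧ IsThin G (U \ T)

theorem IsThin.mono {F F' : Set V} (h : IsThin G F) (hF : F' ⊆ F) : IsThin G F' :=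
  ⟨fun a ha b hb c hc => h.1 a (hF ha) b (hF hb) c (hF hc),
    fun a ha b hb c hc d hd => h.2 a (hF ha) b (hF hb) c (hF hc) d (hF hd)⟩

theorem IsCycleTransversal.isThin {T : Set V} (h : IsCycleTransversal G T) : IsThin G Tᶜ := by
  constructor
  · intro a ha b hb c hc hab hbc hac
    obtain ⟨w, hw, hwT⟩ := h a (Walk.cons hab (Walk.cons hbc (Walk.cons hac.symm Walk.nil))) (by
      simp [Walk.cons_isCycle_iff, hab.ne, hbc.ne, hac.ne, hab.ne', hac.ne'])
    simp only [Walk.support_cons, Walk.support_nil, List.mem_cons, List.not_mem_nil,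
      or_false] at hw
    rcases hw with rfl | rfl | rfl | rfl <;> contradiction
  · intro a ha b hb c hc d hd hac hbd hab hbc hcd hda
    obtain ⟨w, hw, hwT⟩ := h a (Walk.cons hab (Walk.cons hbc (Walk.cons hcd
      (Walk.cons hda Walk.nil)))) (by
        simp [Walk.cons_isCycle_iff, hab.ne, hbc.ne, hcd.ne, hda.ne, hab.ne',
          hda.ne', hac, hbd, hac.symm])
    simp only [Walk.support_cons, Walk.support_nil, List.mem_cons, List.not_mem_nil,
      or_false] at hw
    rcases hw with rfl | rfl | rfl | rfl | rfl <;> contradiction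

theorem exists_two_neighbors_of_isCycle {v x : V} {c : G.Walk v v} (hc : c.IsCycle)
    (hx : x ∈ c.support) :
    ∃ a ∈ c.support, ∃ b ∈ c.support, a ≠ b ∧ G.Adj x a ∧ G.Adj x b := by
  classical
  have hr := hc.rotate hx
  have hmem : ∀ y, y ∈ (c.rotate x hx).support → y ∈ c.support := fun y hy => by
    simpa using hy
  refine ⟨_, hmem _ (Walk.getVert_mem_support _ _), _, hmem _ (Walk.getVert_mem_support _ _),
    hr.snd_ne_penultimate, Walk.adj_snd hr.not_nil, (Walk.adj_penultimate hr.not_nil).symm⟩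

/-- In a distance-hereditary graph every cycle has a triangle or a 4-cycle on its vertices. -/
theorem IsDistanceHereditary.not_isThin_of_isCycle [Finite V] (hG : IsDistanceHereditary G)
    {v : V} {c : G.Walk v v} (hc : c.IsCycle) : ¬ IsThin G {w | w ∈ c.support} := by
  intro hthin
  have hconn := c.connected_induce_support
  obtain ⟨a, ha, b, hb, hab, -⟩ := exists_two_neighbors_of_isCycle hc c.start_mem_support
  have hnt : Nontrivial {w | w ∈ c.support} :=
    ⟨⟨a, ha⟩, ⟨b, hb⟩, fun h => hab (congrArg Subtype.val h)⟩
  -- No vertex of the cycle is pendant, as each has two neighbours on the cycle. Adjacent twins lie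
  -- in a triangle with a further neighbour, nonadjacent twins in a 4-cycle with two common
  -- neighbours.
  obtain ⟨x, y, hne, h⟩ := (hG.induce _).exists_pendant_or_twins hconn
  obtain ⟨a, ha, b, hb, hab, hxa, hxb⟩ := exists_two_neighbors_of_isCycle hc x.2
  rcases h with h | h
  · have h1 := congrArg Subtype.val (h ⟨a, ha⟩ hxa)
    have h2 := congrArg Subtype.val (h ⟨b, hb⟩ hxb)
    exact hab (h1.trans h2.symm)
  · have h' : ∀ z ∈ c.support, z ≠ y.1 → G.Adj x.1 z → G.Adj y.1 z := fun z hz hzy hxz =>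
      (h ⟨z, hz⟩ (fun h => hxz.ne (congrArg Subtype.val h).symm)
        (fun h => hzy (congrArg Subtype.val h))).1 hxz
    have hne' : x.1 ≠ y.1 := fun h => hne (Subtype.ext h)
    by_cases hxy : G.Adj x.1 y.1
    · obtain ⟨z, hz, hzy, hxz⟩ : ∃ z ∈ c.support, z ≠ y.1 ∧ G.Adj x.1 z := by
        by_cases hay : a = y.1
        · exact ⟨b, hb, fun h => hab (hay.trans h.symm), hxb⟩
        · exact ⟨a, ha, hay, hxa⟩
      exact hthin.1 x.1 x.2 y.1 y.2 z hz hxy (h' z hz hzy hxz) hxz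
    · have hay : a ≠ y.1 := by rintro rfl; exact hxy hxa
      have hby : b ≠ y.1 := by rintro rfl; exact hxy hxb
      exact hthin.2 x.1 x.2 a ha y.1 y.2 b hb hne' hab hxa (h' a ha hay hxa).symm
        (h' b hb hby hxb) hxb.symm

theorem IsDistanceHereditary.admitsCCT_iff [Finite V] (hG : IsDistanceHereditary G) :
    AdmitsCCT G ↔ HasCCT G Set.univ := by
  constructor
  · rintro ⟨T, hT, h⟩
    exact ⟨T, Set.subset_univ _, hT, h.isThin.mono (by simp [Set.compl_eq_univ_sdiff])⟩
  · rintro ⟨T, -, hT, h⟩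
    refine ⟨T, hT, fun v c hc => ?_⟩
    by_contra hcon
    push Not at hcon
    exact hG.not_isThin_of_isCycle hc (h.mono fun w hw => ⟨trivial, hcon w hw⟩)

theorem isCycleTransversal_iff_isAcyclic {T : Set V} :
    IsCycleTransversal G T ↔ (G.induce Tᶜ).IsAcyclic := by
  constructor
  · intro h v c hc
    obtain ⟨w, hw, hwT⟩ := h _ (c.map (Embedding.induce Tᶜ).toHom)
      (hc.map (Embedding.induce (G := G) Tᶜ).injective)
    rw [Walk.support_map, List.mem_map] at hw
    obtain ⟨w', -, rfl⟩ := hw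
    exact w'.2 hwT
  · intro h v c hc
    by_contra hcon
    push Not at hcon
    refine h (c.induce Tᶜ hcon) ?_
    rw [← Walk.isCycle_map_iff_of_injective (f := (Embedding.induce (G := G) Tᶜ).toHom)
      (Embedding.induce (G := G) Tᶜ).injective, Walk.map_induce]
    exact hc

theorem admitsCCT_iff_splitsIntoCliqueAndForest :
    AdmitsCCT G ↔ SplitsIntoCliqueAndForest G := by
  constructor
  · rintro ⟨T, hT, h⟩
    exact ⟨T, Tᶜ, Set.union_compl_self T, disjoint_compl_right, hT,
      isCycleTransversal_iff_isAcyclic.1 h⟩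
  · rintro ⟨Q, F, hU, hd, hQ, hF⟩
    obtain rfl : F = Qᶜ :=
      (IsCompl.compl_eq ⟨hd, codisjoint_iff.2 hU⟩).symm
    exact ⟨Q, hQ, isCycleTransversal_iff_isAcyclic.2 hF⟩

/-! ### The forbidden graphs have no clique cycle-transversal -/

theorem HasCCT.of_embedding {W : Type*} {H : SimpleGraph W} (f : H ↪g G)
    (h : HasCCT G Set.univ) : HasCCT H Set.univ := by
  obtain ⟨T, -, hT, h3, h4⟩ := h
  refine ⟨f ⁻¹' T, Set.subset_univ _, ?_, ?_, ?_⟩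
  · intro a ha b hb hne
    exact f.map_rel_iff.1 (hT ha hb (f.injective.ne hne))
  · intro a ha b hb c hc hab hbc hac
    exact h3 (f a) ⟨trivial, ha.2⟩ (f b) ⟨trivial, hb.2⟩ (f c) ⟨trivial, hc.2⟩
      (f.map_rel_iff.2 hab) (f.map_rel_iff.2 hbc) (f.map_rel_iff.2 hac)
  · intro a ha b hb c hc d hd hac hbd hab hbc hcd hda
    exact h4 (f a) ⟨trivial, ha.2⟩ (f b) ⟨trivial, hb.2⟩ (f c) ⟨trivial, hc.2⟩ (f d)
      ⟨trivial, hd.2⟩ (f.injective.ne hac) (f.injective.ne hbd) (f.map_rel_iff.2 hab)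
      (f.map_rel_iff.2 hbc) (f.map_rel_iff.2 hcd) (f.map_rel_iff.2 hda)

/-- A graph has no clique cycle-transversal if every set of vertices that meets all the listed
triangles and 4-cycles contains two nonadjacent vertices. The sets are given by their
characteristic numbers. -/
theorem not_hasCCT_of_cycles {n : ℕ} {H : SimpleGraph (Fin n)}
    (l : List (Fin n × Fin n × Fin n)) (l' : List (Fin n × Fin n × Fin n × Fin n))
    (hl : ∀ c ∈ l, H.Adj c.1 c.2.1 ∧ H.Adj c.2.1 c.2.2 ∧ H.Adj c.1 c.2.2)
    (hl' : ∀ c ∈ l', c.1 ≠ c.2.2.1 ∧ c.2.1 ≠ c.2.2.2 ∧ H.Adj c.1 c.2.1 ∧ H.Adj c.2.1 c.2.2.1 ∧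
      H.Adj c.2.2.1 c.2.2.2 ∧ H.Adj c.2.2.2 c.1)
    (h : ∀ m < 2 ^ n,
      ((l.all fun c => m.testBit c.1 || m.testBit c.2.1 || m.testBit c.2.2) &&
        l'.all fun c => m.testBit c.1 || m.testBit c.2.1 || m.testBit c.2.2.1 ||
          m.testBit c.2.2.2) = true →
      ∃ x y : Fin n, m.testBit x = true ∧ m.testBit y = true ∧ x ≠ y ∧ ¬ H.Adj x y) :
    ¬ HasCCT H Set.univ := by
  classical
  rintro ⟨T, -, hT, h3, h4⟩
  let f : Fin n → Bool := fun x => decide (x ∈ T)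
  have hf : ∀ x : Fin n, (Nat.ofBits f).testBit x = true ↔ x ∈ T := fun x => by
    rw [Nat.testBit_ofBits_lt f x x.2]; simp [f]
  obtain ⟨x, y, hx, hy, hne, hxy⟩ := h (Nat.ofBits f) (Nat.ofBits_lt_two_pow f) (by
    rw [Bool.and_eq_true, List.all_eq_true, List.all_eq_true]
    constructor
    all_goals intro c hc
    · by_contra hcon
      simp only [Bool.or_eq_true, hf, not_or] at hcon
      have := hl c hc
      exact h3 c.1 ⟨trivial, hcon.1.1⟩ c.2.1 ⟨trivial, hcon.1.2⟩ c.2.2 ⟨trivial, hcon.2⟩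
        this.1 this.2.1 this.2.2
    · by_contra hcon
      simp only [Bool.or_eq_true, hf, not_or] at hcon
      have := hl' c hc
      exact h4 c.1 ⟨trivial, hcon.1.1.1⟩ c.2.1 ⟨trivial, hcon.1.1.2⟩ c.2.2.1 ⟨trivial, hcon.1.2⟩
        c.2.2.2 ⟨trivial, hcon.2⟩ this.1 this.2.1 this.2.2.1 this.2.2.2.1 this.2.2.2.2.1
        this.2.2.2.2.2)
  rw [hf] at hx hy
  exact hxy (hT (Set.mem_of_mem_of_subset hx subset_rfl) hy hne)

-- Transversals restrict to induced subgraphs, so it suffices to list, for each of the twelve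
-- graphs, enough short cycles that no clique meets them all; the kernel checks every vertex subset,
-- coded as a number.
set_option maxRecDepth 20000 in
theorem isForbiddenFree_of_hasCCT (h : HasCCT G Set.univ) : IsForbiddenFree G := by
  refine ⟨?_, ?_, ?_, ?_, ?_, ?_, ?_, ?_, ?_, ?_, ?_, ?_⟩ <;> rintro ⟨f⟩ <;>
    refine absurd (h.of_embedding f) ?_
  · exact not_hasCCT_of_cycles [(0, 1, 2), (3, 4, 5)] []
      (by decide +kernel) (by decide +kernel) (by decide +kernel)
  · exact not_hasCCT_of_cycles [(0, 1, 2)] [(3, 4, 5, 6)]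
      (by decide +kernel) (by decide +kernel) (by decide +kernel)
  · exact not_hasCCT_of_cycles [] [(0, 1, 2, 3), (4, 5, 6, 7)]
      (by decide +kernel) (by decide +kernel) (by decide +kernel)
  · exact not_hasCCT_of_cycles []
      [(0, 3, 1, 4), (0, 3, 1, 5), (0, 4, 1, 5), (0, 3, 2, 4), (0, 3, 2, 5), (0, 4, 2, 5),
        (1, 3, 2, 4), (1, 3, 2, 5), (1, 4, 2, 5)]
      (by decide +kernel) (by decide +kernel) (by decide +kernel)
  · exact not_hasCCT_of_cycles [(0, 1, 2), (0, 1, 3), (4, 5, 2), (4, 5, 3)] []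
      (by decide +kernel) (by decide +kernel) (by decide +kernel)
  · exact not_hasCCT_of_cycles
      [(0, 2, 3), (0, 2, 5), (0, 4, 3), (0, 4, 5), (1, 2, 3), (1, 2, 5), (1, 4, 3), (1, 4, 5)] []
      (by decide +kernel) (by decide +kernel) (by decide +kernel)
  · exact not_hasCCT_of_cycles [(0, 1, 2), (0, 1, 3), (4, 5, 6)] []
      (by decide +kernel) (by decide +kernel) (by decide +kernel)
  · exact not_hasCCT_of_cycles [(0, 1, 2), (0, 1, 3)] [(4, 5, 6, 7)]
      (by decide +kernel) (by decide +kernel) (by decide +kernel)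
  · exact not_hasCCT_of_cycles [(4, 6, 7)] [(0, 2, 5, 3), (1, 2, 5, 3)]
      (by decide +kernel) (by decide +kernel) (by decide +kernel)
  · exact not_hasCCT_of_cycles [] [(4, 6, 7, 8), (0, 2, 5, 3), (1, 2, 5, 3)]
      (by decide +kernel) (by decide +kernel) (by decide +kernel)
  · exact not_hasCCT_of_cycles [(2, 5, 6), (3, 5, 6)] [(2, 0, 4, 1), (3, 0, 4, 1)]
      (by decide +kernel) (by decide +kernel) (by decide +kernel)
  · exact not_hasCCT_of_cycles [] [(2, 0, 4, 1), (3, 0, 4, 1), (2, 5, 7, 6), (3, 5, 7, 6)]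
      (by decide +kernel) (by decide +kernel) (by decide +kernel)

/-! ### Recognizing the forbidden graphs -/

theorem isIndContained_ofEdges {n : ℕ} {l : List (Fin n × Fin n)} (f : Fin n → V)
    (h : ∀ i j : Fin n, i < j →
      if (ofEdges n l).Adj i j then G.Adj (f i) (f j) else f i ≠ f j ∧ ¬ G.Adj (f i) (f j)) :
    (ofEdges n l).IsIndContained G := by
  have hne : ∀ i j : Fin n, i < j → f i ≠ f j := by
    intro i j hij
    have := h i j hij
    split_ifs at this with hadj
    · exact this.ne
    · exact this.1
  have hiff : ∀ i j : Fin n, i < j → (G.Adj (f i) (f j) ↔ (ofEdges n l).Adj i j) := by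
    intro i j hij
    have := h i j hij
    split_ifs at this with hadj
    · exact iff_of_true this hadj
    · exact iff_of_false this.2 hadj
  refine ⟨⟨⟨f, fun i j hij => ?_⟩, ?_⟩⟩
  · by_contra hne'
    rcases lt_or_gt_of_ne hne' with hlt | hlt
    · exact hne i j hlt hij
    · exact hne j i hlt hij.symm
  · intro i j
    show G.Adj (f i) (f j) ↔ _
    rcases lt_trichotomy i j with hlt | rfl | hlt
    · exact hiff i j hlt
    · simp
    · rw [G.adj_comm, (ofEdges n l).adj_comm]; exact hiff j i hlt

/-- The set is the vertex set of a triangle or of an induced 4-cycle. -/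
def IsShortCycle (G : SimpleGraph V) (C : Set V) : Prop :=
  (∃ x y z, C = {x, y, z} ∧ G.Adj x y ∧ G.Adj y z ∧ G.Adj x z) ∨
  ∃ x y z w, C = {x, y, z, w} ∧ G.Adj x y ∧ G.Adj y z ∧ G.Adj z w ∧ G.Adj w x ∧ x ≠ z ∧ y ≠ w ∧
    ¬ G.Adj x z ∧ ¬ G.Adj y w

/-- A 4-cycle with a chord contains a triangle, so the remaining 4-cycles may be taken to be
induced. -/
theorem exists_isShortCycle {F : Set V} (h : ¬ IsThin G F) : ∃ C ⊆ F, IsShortCycle G C := by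
  have htri : ∀ a ∈ F, ∀ b ∈ F, ∀ c ∈ F, G.Adj a b → G.Adj b c → G.Adj a c →
      ∃ C ⊆ F, IsShortCycle G C := by
    intro a ha b hb c hc hab hbc hac
    refine ⟨{a, b, c}, ?_, Or.inl ⟨a, b, c, rfl, hab, hbc, hac⟩⟩
    rintro x (rfl | rfl | rfl) <;> assumption
  by_contra hcon
  refine h ⟨fun a ha b hb c hc hab hbc hac => hcon (htri a ha b hb c hc hab hbc hac), ?_⟩
  intro a ha b hb c hc d hd hac hbd hab hbc hcd hda
  by_cases h1 : G.Adj a c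
  · exact hcon (htri a ha b hb c hc hab hbc h1)
  by_cases h2 : G.Adj b d
  · exact hcon (htri b hb c hc d hd hbc hcd h2)
  refine hcon ⟨{a, b, c, d}, ?_, Or.inr ⟨a, b, c, d, rfl, hab, hbc, hcd, hda, hac, hbd, h1, h2⟩⟩
  rintro x (rfl | rfl | rfl | rfl) <;> assumption

theorem IsShortCycle.not_isThin {C : Set V} (h : IsShortCycle G C) : ¬ IsThin G C := by
  rintro ⟨h3, h4⟩
  rcases h with ⟨x, y, z, rfl, hxy, hyz, hxz⟩ |
    ⟨x, y, z, w, rfl, hxy, hyz, hzw, hwx, hxz, hyw, -, -⟩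
  · exact h3 x (by simp) y (by simp) z (by simp) hxy hyz hxz
  · exact h4 x (by simp) y (by simp) z (by simp) w (by simp) hxz hyw hxy hyz hzw hwx

/-- Two disjoint sets without edges between them are not both cyclic. -/
theorem IsForbiddenFree.isThin_or_isThin (hF : IsForbiddenFree G) {A B : Set V}
    (hd : Disjoint A B) (hAB : ∀ a ∈ A, ∀ b ∈ B, ¬ G.Adj a b) : IsThin G A ∨ IsThin G B := by
  by_contra hcon
  push Not at hcon
  obtain ⟨C, hC, hCc⟩ := exists_isShortCycle hcon.1
  obtain ⟨D, hD, hDc⟩ := exists_isShortCycle hcon.2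
  have hne : ∀ a ∈ C, ∀ b ∈ D, a ≠ b ∧ ¬ G.Adj a b := fun a ha b hb =>
    ⟨hd.ne_of_mem (hC ha) (hD hb), hAB a (hC ha) b (hD hb)⟩
  have hne' : ∀ a ∈ C, ∀ b ∈ D, b ≠ a ∧ ¬ G.Adj b a := fun a ha b hb =>
    ⟨(hne a ha b hb).1.symm, fun h => (hne a ha b hb).2 h.symm⟩
  clear hC hD hAB hd hcon
  obtain ⟨hG1, hG2, hG3, -⟩ := hF
  rcases hCc with ⟨x, y, z, rfl, hxy, hyz, hxz⟩ |
      ⟨x, y, z, w, rfl, hxy, hyz, hzw, hwx, hxz, hyw, hxz', hyw'⟩ <;>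
    rcases hDc with ⟨a, b, c, rfl, hab, hbc, hac⟩ |
      ⟨a, b, c, d, rfl, hab, hbc, hcd, hda, hac, hbd, hac', hbd'⟩ <;>
    simp only [Set.mem_insert_iff, Set.mem_singleton_iff, forall_eq_or_imp, forall_eq] at hne hne'
  · refine hG1 (isIndContained_ofEdges ![x, y, z, a, b, c] ?_)
    intro i j hij
    fin_cases i <;> fin_cases j <;> first
      | exact absurd hij (by decide)
      | simp [ofEdges, *]
  · refine hG2 (isIndContained_ofEdges ![x, y, z, a, b, c, d] ?_)
    intro i j hij
    fin_cases i <;> fin_cases j <;> first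
      | exact absurd hij (by decide)
      | simp [ofEdges, *, hda.symm]
  · refine hG2 (isIndContained_ofEdges ![a, b, c, x, y, z, w] ?_)
    intro i j hij
    fin_cases i <;> fin_cases j <;> first
      | exact absurd hij (by decide)
      | simp [ofEdges, *, hwx.symm]
  · refine hG3 (isIndContained_ofEdges ![x, y, z, w, a, b, c, d] ?_)
    intro i j hij
    fin_cases i <;> fin_cases j <;> first
      | exact absurd hij (by decide)
      | simp [ofEdges, *, hwx.symm, hda.symm]

/-- A forbidden-free graph contains no induced complete bipartite graph with parts of size
three. -/
theorem IsForbiddenFree.no_bipartite (hF : IsForbiddenFree G) {a b c x y z : V}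
    (hab : a ≠ b ∧ ¬ G.Adj a b) (hac : a ≠ c ∧ ¬ G.Adj a c) (hbc : b ≠ c ∧ ¬ G.Adj b c)
    (hxy : x ≠ y ∧ ¬ G.Adj x y) (hxz : x ≠ z ∧ ¬ G.Adj x z) (hyz : y ≠ z ∧ ¬ G.Adj y z)
    (ha : G.Adj a x ∧ G.Adj a y ∧ G.Adj a z) (hb : G.Adj b x ∧ G.Adj b y ∧ G.Adj b z)
    (hc : G.Adj c x ∧ G.Adj c y ∧ G.Adj c z) : False := by
  refine hF.2.2.2.1 (isIndContained_ofEdges ![a, b, c, x, y, z] ?_)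
  intro i j hij
  fin_cases i <;> fin_cases j <;> first
    | exact absurd hij (by decide)
    | simp [ofEdges, *]

/-- A forbidden-free graph contains no induced octahedron. -/
theorem IsForbiddenFree.no_octahedron (hF : IsForbiddenFree G) {p q a b c d : V}
    (hpq : p ≠ q ∧ ¬ G.Adj p q) (hab : a ≠ b ∧ ¬ G.Adj a b) (hcd : c ≠ d ∧ ¬ G.Adj c d)
    (hp : G.Adj p a ∧ G.Adj p b ∧ G.Adj p c ∧ G.Adj p d)
    (hq : G.Adj q a ∧ G.Adj q b ∧ G.Adj q c ∧ G.Adj q d)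
    (ha : G.Adj a c ∧ G.Adj a d) (hb : G.Adj b c ∧ G.Adj b d) : False := by
  refine hF.2.2.2.2.2.1 (isIndContained_ofEdges ![p, q, a, c, b, d] ?_)
  have := hb.1.symm
  intro i j hij
  fin_cases i <;> fin_cases j <;> first
    | exact absurd hij (by decide)
    | simp [ofEdges, *]

/-! ### Links of sets attached to two nonadjacent vertices -/

/-- The set `A` with the marked vertices `S` contains two adjacent marked vertices, or two
nonadjacent marked vertices with an unmarked common neighbour. -/
def HasShortLink (G : SimpleGraph V) (A S : Set V) : Prop :=
  (∃ s ∈ S, ∃ t ∈ S, G.Adj s t) ∨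
  ∃ s ∈ S, ∃ t ∈ S, ∃ w ∈ A \ S, s ≠ t ∧ ¬ G.Adj s t ∧ G.Adj s w ∧ G.Adj t w

/-- The set `A` with the marked vertices `S` contains a triangle or an induced 4-cycle with
exactly one marked vertex. -/
def HasCyclicLink (G : SimpleGraph V) (A S : Set V) : Prop :=
  (∃ s ∈ S, ∃ x ∈ A \ S, ∃ y ∈ A \ S, G.Adj s x ∧ G.Adj x y ∧ G.Adj s y) ∨
  ∃ s ∈ S, ∃ x ∈ A \ S, ∃ y ∈ A \ S, ∃ z ∈ A \ S, G.Adj s x ∧ G.Adj x y ∧ G.Adj y z ∧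
    G.Adj s z ∧ s ≠ y ∧ x ≠ z ∧ ¬ G.Adj s y ∧ ¬ G.Adj x z

/-- Two marked sets without edges between them, both attached to two nonadjacent vertices `p`
and `q` by their marked vertices. -/
structure AreAttached (G : SimpleGraph V) (p q : V) (A S B R : Set V) : Prop where
  ne : p ≠ q
  not_adj : ¬ G.Adj p q
  subset_left : S ⊆ A
  subset_right : R ⊆ B
  notMem_left : p ∉ A ∧ q ∉ A
  notMem_right : p ∉ B ∧ q ∉ B
  adj_left : ∀ x ∈ A, (G.Adj p x ↔ x ∈ S) ∧ (G.Adj q x ↔ x ∈ S)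
  adj_right : ∀ x ∈ B, (G.Adj p x ↔ x ∈ R) ∧ (G.Adj q x ↔ x ∈ R)
  disjoint : Disjoint A B
  not_adj_of_mem : ∀ a ∈ A, ∀ b ∈ B, ¬ G.Adj a b

namespace AreAttached

variable {p q : V} {A S B R : Set V}

theorem symm (h : AreAttached G p q A S B R) : AreAttached G p q B R A S :=
  ⟨h.ne, h.not_adj, h.subset_right, h.subset_left, h.notMem_right, h.notMem_left, h.adj_right,
    h.adj_left, h.disjoint.symm, fun a ha b hb hab => h.not_adj_of_mem b hb a ha hab.symm⟩

theorem adj_of_mem (h : AreAttached G p q A S B R) {x : V} (hx : x ∈ S) :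
    (G.Adj p x ∧ G.Adj q x) ∧ G.Adj x p ∧ G.Adj x q := by
  have := h.adj_left x (h.subset_left hx)
  exact ⟨⟨this.1.2 hx, this.2.2 hx⟩, (this.1.2 hx).symm, (this.2.2 hx).symm⟩

theorem not_adj_of_notMem (h : AreAttached G p q A S B R) {x : V} (hx : x ∈ A \ S) :
    ((¬ G.Adj p x ∧ ¬ G.Adj q x) ∧ ¬ G.Adj x p ∧ ¬ G.Adj x q) ∧
      (p ≠ x ∧ q ≠ x) ∧ x ≠ p ∧ x ≠ q := by
  have := h.adj_left x hx.1
  have h1 : ¬ G.Adj p x := fun h' => hx.2 (this.1.1 h')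
  have h2 : ¬ G.Adj q x := fun h' => hx.2 (this.2.1 h')
  have h3 : x ≠ p := fun h' => h.notMem_left.1 (h' ▸ hx.1)
  have h4 : x ≠ q := fun h' => h.notMem_left.2 (h' ▸ hx.1)
  exact ⟨⟨⟨h1, h2⟩, fun h => h1 h.symm, fun h => h2 h.symm⟩, ⟨h3.symm, h4.symm⟩, h3, h4⟩

theorem cross (h : AreAttached G p q A S B R) {a b : V} (ha : a ∈ A) (hb : b ∈ B) :
    (a ≠ b ∧ b ≠ a) ∧ ¬ G.Adj a b ∧ ¬ G.Adj b a :=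
  ⟨⟨h.disjoint.ne_of_mem ha hb, (h.disjoint.ne_of_mem ha hb).symm⟩, h.not_adj_of_mem a ha b hb,
    fun h' => h.not_adj_of_mem a ha b hb h'.symm⟩

/-- Either of `p` and `q` closes a short cycle with each short link, and a clique contains at most
one of `p` and `q`. Two edges give `G5`, an edge and a cherry `G11`, two cherries `G12`. -/
theorem false_of_hasShortLink (h : AreAttached G p q A S B R) (hF : IsForbiddenFree G)
    (hA : HasShortLink G A S) (hB : HasShortLink G B R) : False := by
  obtain ⟨-, -, -, -, hG5, -, -, -, -, -, hG11, hG12⟩ := hF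
  have hpq := h.not_adj
  have hne := h.ne
  have hSA := h.subset_left
  have hRB := h.subset_right
  rcases hA with ⟨s, hs, t, ht, hst⟩ | ⟨s, hs, t, ht, w, hw, hst, hst', hsw, htw⟩
  · have hs' := h.adj_of_mem hs
    have ht' := h.adj_of_mem ht
    rcases hB with ⟨a, ha, b, hb, hab⟩ | ⟨a, ha, b, hb, c, hc, hab, hab', hac, hbc⟩
    · have ha' := h.symm.adj_of_mem ha
      have hb' := h.symm.adj_of_mem hb
      have h1 := h.cross (hSA hs) (hRB ha)
      have h2 := h.cross (hSA hs) (hRB hb)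
      have h3 := h.cross (hSA ht) (hRB ha)
      have h4 := h.cross (hSA ht) (hRB hb)
      refine hG5 (isIndContained_ofEdges ![s, t, p, q, a, b] ?_)
      intro i j hij
      fin_cases i <;> fin_cases j <;> first
        | exact absurd hij (by decide)
        | simp [ofEdges, *]
    · have ha' := h.symm.adj_of_mem ha
      have hb' := h.symm.adj_of_mem hb
      have hc' := h.symm.not_adj_of_notMem hc
      have h1 := h.cross (hSA hs) (hRB ha)
      have h2 := h.cross (hSA hs) (hRB hb)
      have h3 := h.cross (hSA hs) hc.1
      have h4 := h.cross (hSA ht) (hRB ha)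
      have h5 := h.cross (hSA ht) (hRB hb)
      have h6 := h.cross (hSA ht) hc.1
      refine hG11 (isIndContained_ofEdges ![a, b, p, q, c, s, t] ?_)
      intro i j hij
      fin_cases i <;> fin_cases j <;> first
        | exact absurd hij (by decide)
        | simp [ofEdges, *]
  · have hs' := h.adj_of_mem hs
    have ht' := h.adj_of_mem ht
    have hw' := h.not_adj_of_notMem hw
    rcases hB with ⟨a, ha, b, hb, hab⟩ | ⟨a, ha, b, hb, c, hc, hab, hab', hac, hbc⟩
    · have ha' := h.symm.adj_of_mem ha
      have hb' := h.symm.adj_of_mem hb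
      have h1 := h.cross (hSA hs) (hRB ha)
      have h2 := h.cross (hSA hs) (hRB hb)
      have h3 := h.cross (hSA ht) (hRB ha)
      have h4 := h.cross (hSA ht) (hRB hb)
      have h5 := h.cross hw.1 (hRB ha)
      have h6 := h.cross hw.1 (hRB hb)
      refine hG11 (isIndContained_ofEdges ![s, t, p, q, w, a, b] ?_)
      intro i j hij
      fin_cases i <;> fin_cases j <;> first
        | exact absurd hij (by decide)
        | simp [ofEdges, *]
    · have ha' := h.symm.adj_of_mem ha
      have hb' := h.symm.adj_of_mem hb
      have hc' := h.symm.not_adj_of_notMem hc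
      have h1 := h.cross (hSA hs) (hRB ha)
      have h2 := h.cross (hSA hs) (hRB hb)
      have h3 := h.cross (hSA hs) hc.1
      have h4 := h.cross (hSA ht) (hRB ha)
      have h5 := h.cross (hSA ht) (hRB hb)
      have h6 := h.cross (hSA ht) hc.1
      have h7 := h.cross hw.1 (hRB ha)
      have h8 := h.cross hw.1 (hRB hb)
      have h9 := h.cross hw.1 hc.1
      refine hG12 (isIndContained_ofEdges ![s, t, p, q, w, a, b, c] ?_)
      intro i j hij
      fin_cases i <;> fin_cases j <;> first
        | exact absurd hij (by decide)
        | simp [ofEdges, *]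

/-- An edge with a pendant triangle or 4-cycle gives `G7` or `G8`; a cherry gives `G9` or `G10`. -/
theorem false_of_hasCyclicLink (h : AreAttached G p q A S B R) (hF : IsForbiddenFree G)
    (hA : HasShortLink G A S) (hB : HasCyclicLink G B R) : False := by
  obtain ⟨-, -, -, -, -, -, hG7, hG8, hG9, hG10, -, -⟩ := hF
  have hpq := h.not_adj
  have hne := h.ne
  have hSA := h.subset_left
  have hRB := h.subset_right
  rcases hA with ⟨s, hs, t, ht, hst⟩ | ⟨s, hs, t, ht, w, hw, hst, hst', hsw, htw⟩
  · have hs' := h.adj_of_mem hs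
    have ht' := h.adj_of_mem ht
    rcases hB with ⟨a, ha, x, hx, y, hy, hax, hxy, hay⟩ |
      ⟨a, ha, x, hx, y, hy, z, hz, hax, hxy, hyz, haz, hne1, hne2, hay, hxz⟩
    · have ha' := h.symm.adj_of_mem ha
      have hx' := h.symm.not_adj_of_notMem hx
      have hy' := h.symm.not_adj_of_notMem hy
      have h1 := h.cross (hSA hs) (hRB ha)
      have h2 := h.cross (hSA hs) hx.1
      have h3 := h.cross (hSA hs) hy.1
      have h4 := h.cross (hSA ht) (hRB ha)
      have h5 := h.cross (hSA ht) hx.1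
      have h6 := h.cross (hSA ht) hy.1
      refine hG7 (isIndContained_ofEdges ![s, t, p, q, a, x, y] ?_)
      intro i j hij
      fin_cases i <;> fin_cases j <;> first
        | exact absurd hij (by decide)
        | simp [ofEdges, *]
    · have ha' := h.symm.adj_of_mem ha
      have hx' := h.symm.not_adj_of_notMem hx
      have hy' := h.symm.not_adj_of_notMem hy
      have hz' := h.symm.not_adj_of_notMem hz
      have h1 := h.cross (hSA hs) (hRB ha)
      have h2 := h.cross (hSA hs) hx.1
      have h3 := h.cross (hSA hs) hy.1
      have h4 := h.cross (hSA ht) (hRB ha)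
      have h5 := h.cross (hSA ht) hx.1
      have h6 := h.cross (hSA ht) hy.1
      have h7 := h.cross (hSA hs) hz.1
      have h8 := h.cross (hSA ht) hz.1
      refine hG8 (isIndContained_ofEdges ![s, t, p, q, a, x, y, z] ?_)
      intro i j hij
      fin_cases i <;> fin_cases j <;> first
        | exact absurd hij (by decide)
        | simp [ofEdges, *]
  · have hs' := h.adj_of_mem hs
    have ht' := h.adj_of_mem ht
    have hw' := h.not_adj_of_notMem hw
    rcases hB with ⟨a, ha, x, hx, y, hy, hax, hxy, hay⟩ |
      ⟨a, ha, x, hx, y, hy, z, hz, hax, hxy, hyz, haz, hne1, hne2, hay, hxz⟩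
    · have ha' := h.symm.adj_of_mem ha
      have hx' := h.symm.not_adj_of_notMem hx
      have hy' := h.symm.not_adj_of_notMem hy
      have h1 := h.cross (hSA hs) (hRB ha)
      have h2 := h.cross (hSA hs) hx.1
      have h3 := h.cross (hSA hs) hy.1
      have h4 := h.cross (hSA ht) (hRB ha)
      have h5 := h.cross (hSA ht) hx.1
      have h6 := h.cross (hSA ht) hy.1
      have h7 := h.symm.cross (hRB ha) hw.1
      have h8 := h.cross hw.1 hx.1
      have h9 := h.cross hw.1 hy.1
      refine hG9 (isIndContained_ofEdges ![p, q, s, t, a, w, x, y] ?_)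
      intro i j hij
      fin_cases i <;> fin_cases j <;> first
        | exact absurd hij (by decide)
        | simp [ofEdges, *]
    · have ha' := h.symm.adj_of_mem ha
      have hx' := h.symm.not_adj_of_notMem hx
      have hy' := h.symm.not_adj_of_notMem hy
      have hz' := h.symm.not_adj_of_notMem hz
      have h1 := h.cross (hSA hs) (hRB ha)
      have h2 := h.cross (hSA hs) hx.1
      have h3 := h.cross (hSA hs) hy.1
      have h4 := h.cross (hSA ht) (hRB ha)
      have h5 := h.cross (hSA ht) hx.1
      have h6 := h.cross (hSA ht) hy.1
      have h7 := h.symm.cross (hRB ha) hw.1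
      have h8 := h.cross hw.1 hx.1
      have h9 := h.cross hw.1 hy.1
      have h10 := h.cross (hSA hs) hz.1
      have h11 := h.cross (hSA ht) hz.1
      have h12 := h.cross hw.1 hz.1
      refine hG10 (isIndContained_ofEdges ![p, q, s, t, a, w, x, y, z] ?_)
      intro i j hij
      fin_cases i <;> fin_cases j <;> first
        | exact absurd hij (by decide)
        | simp [ofEdges, *]

end AreAttached

theorem HasCyclicLink.not_isThin {A S : Set V} (h : HasCyclicLink G A S) (hSA : S ⊆ A) :
    ¬ IsThin G A := by
  rintro ⟨h3, h4⟩
  rcases h with ⟨s, hs, x, hx, y, hy, hsx, hxy, hsy⟩ |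
    ⟨s, hs, x, hx, y, hy, z, hz, hsx, hxy, hyz, hsz, hne1, hne2, -, -⟩
  · exact h3 s (hSA hs) x hx.1 y hy.1 hsx hxy hsy
  · exact h4 s (hSA hs) x hx.1 y hy.1 z hz.1 hne1 hne2 hsx hxy hyz hsz.symm

/-- The set `A` with the marked vertices `S` contains a short or a cyclic link. -/
def HasLink (G : SimpleGraph V) (A S : Set V) : Prop :=
  HasShortLink G A S ∨ HasCyclicLink G A S

/-- Two nonadjacent vertices are not both attached to two separate sets with links. -/
theorem AreAttached.false_of_hasLink {p q : V} {A S B R : Set V}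
    (h : AreAttached G p q A S B R) (hF : IsForbiddenFree G) (hA : HasLink G A S)
    (hB : HasLink G B R) : False := by
  rcases hA with hA | hA
  · rcases hB with hB | hB
    · exact h.false_of_hasShortLink hF hA hB
    · exact h.false_of_hasCyclicLink hF hA hB
  · rcases hB with hB | hB
    · exact h.symm.false_of_hasCyclicLink hF hB hA
    · rcases hF.isThin_or_isThin h.disjoint h.not_adj_of_mem with h' | h'
      · exact hA.not_isThin h.subset_left h'
      · exact hB.not_isThin h.subset_right h'

/-! ### Unions of thin sets -/

/-- No two vertices of `R` in `F` are adjacent or have a common neighbour in `F`. -/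
def IsUnlinked (G : SimpleGraph V) (F R : Set V) : Prop :=
  ∀ r ∈ F, r ∈ R → ∀ t ∈ F, t ∈ R → r ≠ t → ¬ G.Adj r t ∧ ∀ w ∈ F, G.Adj r w → ¬ G.Adj w t

theorem isUnlinked_of_subsingleton {F R : Set V} (h : (R ∩ F).Subsingleton) :
    IsUnlinked G F R :=
  fun _ hr hrR _ ht htR hne => absurd (h ⟨hrR, hr⟩ ⟨htR, ht⟩) hne

/-- A triangle or 4-cycle meeting both sets must pass through the only vertex of S left in F, and
its two neighbours on the cycle in F' are vertices of R that are adjacent or have a common neighbour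
in F'. -/
theorem IsThin.union {F F' S R : Set V} (hF : IsThin G F) (hF' : IsThin G F')
    (hd : Disjoint F F') (hadj : ∀ a ∈ F, ∀ b ∈ F', G.Adj a b → a ∈ S ∧ b ∈ R)
    (hS : (S ∩ F).Subsingleton) (hR : IsUnlinked G F' R) : IsThin G (F ∪ F') := by
  obtain ⟨h3, h4⟩ := hF
  obtain ⟨h3', h4'⟩ := hF'
  have hS' : ∀ a ∈ F, ∀ b ∈ F, a ∈ S → b ∈ S → a = b := fun a ha b hb h h' => hS ⟨h, ha⟩ ⟨h', hb⟩
  have hadj' : ∀ a ∈ F, ∀ b ∈ F', G.Adj b a → a ∈ S ∧ b ∈ R :=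
    fun a ha b hb h => hadj a ha b hb h.symm
  have hne : ∀ a ∈ F, ∀ b ∈ F', a ≠ b := fun a ha b hb => hd.ne_of_mem ha hb
  have hone : ∀ a ∈ F, ∀ b ∈ F', ∀ c ∈ F', b ≠ c → G.Adj a b → G.Adj a c →
      ¬ G.Adj b c ∧ ∀ w ∈ F', G.Adj b w → ¬ G.Adj w c := fun a ha b hb c hc hbc hab hac =>
    hR b hb (hadj a ha b hb hab).2 c hc (hadj a ha c hc hac).2 hbc
  have htwo : ∀ a ∈ F, ∀ b ∈ F, ∀ c ∈ F', ∀ d ∈ F', G.Adj a c → G.Adj b d → a = b :=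
    fun a ha b hb c hc d hd hac hbd => hS' a ha b hb (hadj a ha c hc hac).1 (hadj b hb d hd hbd).1
  clear hS hR hd hadj hadj' hS'
  have hsym : ∀ a b, G.Adj a b → G.Adj b a := fun a b h => h.symm
  constructor
  · rintro a (ha | ha) b (hb | hb) c (hc | hc) hab hbc hac
    · exact h3 a ha b hb c hc hab hbc hac
    · exact hab.ne (htwo a ha b hb c hc c hc hac hbc)
    · exact hac.ne (htwo a ha c hc b hb b hb hab hbc.symm)
    · exact (hone a ha b hb c hc hbc.ne hab hac).1 hbc
    · exact hbc.ne (htwo b hb c hc a ha a ha hab.symm hac.symm)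
    · exact (hone b hb a ha c hc hac.ne hab.symm hbc).1 hac
    · exact (hone c hc a ha b hb hab.ne hac.symm hbc.symm).1 hab
    · exact h3' a ha b hb c hc hab hbc hac
  · have hquad : ∀ a ∈ F, ∀ b ∈ F', ∀ c ∈ F ∪ F', ∀ d ∈ F ∪ F', a ≠ c → b ≠ d → G.Adj a b →
        G.Adj b c → G.Adj c d → G.Adj d a → False := by
      rintro a ha b hb c (hc | hc) d (hd | hd) hac hbd hab hbc hcd hda
      · exact hac (htwo a ha c hc b hb b hb hab hbc.symm)
      · exact hac (htwo a ha c hc b hb b hb hab hbc.symm)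
      · exact hda.ne (htwo d hd a ha c hc b hb hcd.symm hab)
      · exact (hone a ha b hb d hd hbd hab hda.symm).2 c hc hbc hcd
    rintro a (ha | ha) b (hb | hb) c hc d hd hac hbd hab hbc hcd hda
    · rcases hc with hc | hc
      · rcases hd with hd | hd
        · exact h4 a ha b hb c hc d hd hac hbd hab hbc hcd hda
        · exact hquad c hc d hd a (Or.inl ha) b (Or.inl hb) hac.symm hbd.symm hcd hda hab hbc
      · exact hquad b hb c hc d hd a (Or.inl ha) hbd hac.symm hbc hcd hda hab
    · exact hquad a ha b hb c hc d hd hac hbd hab hbc hcd hda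
    · exact hquad b hb a ha d hd c hc hbd hac hab.symm hda.symm hcd.symm hbc.symm
    · rcases hc with hc | hc
      · exact hquad c hc b (hb) a (Or.inr ha) d hd hac.symm hbd hbc.symm hab.symm hda.symm
          hcd.symm
      · rcases hd with hd | hd
        · exact hquad d hd a ha b (Or.inr hb) c (Or.inr hc) hbd.symm hac hda hab hbc hcd
        · exact h4' a ha b hb c hc d hd hac hbd hab hbc hcd hda

theorem IsThin.union_of_not_adj {F F' : Set V} (hF : IsThin G F) (hF' : IsThin G F')
    (hd : Disjoint F F') (hadj : ∀ a ∈ F, ∀ b ∈ F', ¬ G.Adj a b) : IsThin G (F ∪ F') :=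
  hF.union (S := ∅) (R := ∅) hF' hd (fun a ha b hb h => absurd h (hadj a ha b hb)) (by simp)
    (isUnlinked_of_subsingleton (by simp))

theorem isThin_of_independent {F : Set V} (h : ∀ a ∈ F, ∀ b ∈ F, ¬ G.Adj a b) : IsThin G F :=
  ⟨fun a ha b hb _ _ hab _ _ => h a ha b hb hab,
    fun a ha b hb _ _ _ _ _ _ hab _ _ _ => h a ha b hb hab⟩

theorem isThin_triple {x y z : V} (h : ¬ G.Adj x z) : IsThin G {x, y, z} := by
  have h' : ¬ G.Adj z x := fun h' => h h'.symm
  constructor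
  · rintro a (rfl | rfl | rfl) b (rfl | rfl | rfl) c (rfl | rfl | rfl) <;> simp_all
  · rintro a (rfl | rfl | rfl) b (rfl | rfl | rfl) c (rfl | rfl | rfl) d (rfl | rfl | rfl) <;>
      simp_all

theorem isThin_pair (x y : V) : IsThin G {x, y} := by
  have := isThin_triple (G := G) (x := x) (y := y) (z := x) (G.irrefl)
  exact this.mono (by intro a; simp; tauto)

/-! ### Simple marked sets -/

/-- The set consists of four vertices that induce a 4-cycle. -/
def IsFourCycle (G : SimpleGraph V) (A : Set V) : Prop :=
  ∃ a b c d, A = {a, b, c, d} ∧ G.Adj a b ∧ G.Adj b c ∧ G.Adj c d ∧ G.Adj d a ∧ a ≠ c ∧ b ≠ d ∧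
    ¬ G.Adj a c ∧ ¬ G.Adj b d

/-- Marked sets as they occur in minimal graphs without clique cycle-transversal. -/
structure IsSimple (G : SimpleGraph V) (A S : Set V) : Prop where
  subset : S ⊆ A
  transversal : (∃ T ⊆ S, G.IsClique T ∧ IsThin G (A \ T) ∧ (S \ T).Subsingleton) ∨
    (S = A ∧ IsFourCycle G A)
  link : HasLink G A S ∨ (A = S ∧ ∀ s ∈ S, ∀ t ∈ S, ¬ G.Adj s t)

theorem isSimple_empty : IsSimple G ∅ ∅ :=
  ⟨subset_rfl, Or.inl ⟨∅, subset_rfl, by simp, isThin_of_independent (by simp), by simp⟩,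
    Or.inr ⟨rfl, by simp⟩⟩

theorem isSimple_singleton (s : V) : IsSimple G {s} {s} :=
  ⟨subset_rfl, Or.inl ⟨∅, by simp, by simp, isThin_of_independent (by simp), by simp⟩,
    Or.inr ⟨rfl, by simp⟩⟩

theorem isSimple_nonadjacent {s t : V} (hst : ¬ G.Adj s t) : IsSimple G {s, t} {s, t} := by
  have hind : ∀ a ∈ ({s, t} : Set V), ∀ b ∈ ({s, t} : Set V), ¬ G.Adj a b := by
    have : ¬ G.Adj t s := fun h => hst h.symm
    rintro a (rfl | rfl) b (rfl | rfl) <;> simp_all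
  refine ⟨subset_rfl, Or.inl ⟨{s}, by simp, by simp, (isThin_of_independent hind).mono
    Set.sdiff_subset, ?_⟩, Or.inr ⟨rfl, hind⟩⟩
  rintro x ⟨rfl | rfl, hx⟩ y ⟨rfl | rfl, hy⟩ <;> simp_all

theorem isSimple_adjacent {s t : V} (hst : G.Adj s t) : IsSimple G {s, t} {s, t} := by
  refine ⟨subset_rfl, Or.inl ⟨{s}, by simp, by simp, (isThin_pair s t).mono
    Set.sdiff_subset, ?_⟩, Or.inl (Or.inl (Or.inl ⟨s, by simp, t, by simp, hst⟩))⟩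
  rintro x ⟨rfl | rfl, hx⟩ y ⟨rfl | rfl, hy⟩ <;> simp_all

theorem isSimple_cherry {s t w : V} (hst : ¬ G.Adj s t) (hne : s ≠ t) (hsw : G.Adj s w)
    (htw : G.Adj t w) : IsSimple G {s, t, w} {s, t} := by
  refine ⟨by intro x; simp; tauto, Or.inl ⟨{s}, by simp, by simp, (isThin_pair t w).mono ?_, ?_⟩,
    Or.inl (Or.inl (Or.inr ⟨s, by simp, t, by simp, w, ?_, hne, hst, hsw, htw⟩))⟩
  · rintro x ⟨rfl | rfl | rfl, hx⟩ <;> simp_all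
  · rintro x ⟨rfl | rfl, hx⟩ y ⟨rfl | rfl, hy⟩ <;> simp_all
  · simp [hsw.ne', htw.ne']

theorem isSimple_triangle {x y z : V} {S : Set V} (hxy : G.Adj x y) (hyz : G.Adj y z)
    (hxz : G.Adj x z) (hS : S ⊆ {x, y, z}) (hx : x ∈ S) : IsSimple G {x, y, z} S := by
  have hclique : G.IsClique S := by
    have : G.IsClique {x, y, z} := by
      rintro a (rfl | rfl | rfl) b (rfl | rfl | rfl) hab <;> simp_all [G.adj_comm]
    exact this.subset hS
  refine ⟨hS, Or.inl ⟨S, subset_rfl, hclique, (isThin_pair y z).mono ?_, by simp⟩, Or.inl ?_⟩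
  · rintro a ⟨rfl | rfl | rfl, ha⟩ <;> simp_all
  · by_cases hy : y ∈ S
    · exact Or.inl (Or.inl ⟨x, hx, y, hy, hxy⟩)
    by_cases hz : z ∈ S
    · exact Or.inl (Or.inl ⟨x, hx, z, hz, hxz⟩)
    exact Or.inr (Or.inl ⟨x, hx, y, ⟨by simp, hy⟩, z, ⟨by simp, hz⟩, hxy, hyz, hxz⟩)

/-- With `x` unmarked the marks lie on the path y z w. If `z` is marked, the removed clique consists
of `z` and, if marked, `y`; otherwise a single marked vertex suffices. -/
theorem isSimple_fourCycle_of_notMem {x y z w : V} {S : Set V} (hxy : G.Adj x y)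
    (hyz : G.Adj y z) (hzw : G.Adj z w) (hwx : G.Adj w x) (hxz : x ≠ z) (hyw : y ≠ w)
    (hxz' : ¬ G.Adj x z) (hyw' : ¬ G.Adj y w) (hS : S ⊆ {x, y, z, w}) (hne : S.Nonempty)
    (hx : x ∉ S) : IsSimple G {x, y, z, w} S := by
  have hwy' : ¬ G.Adj w y := fun h => hyw' h.symm
  have hzx' : ¬ G.Adj z x := fun h => hxz' h.symm
  have hmem : ∀ a ∈ S, a = y ∨ a = z ∨ a = w := by
    intro a ha
    rcases hS ha with rfl | h
    · exact absurd ha hx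
    · exact h
  refine ⟨hS, Or.inl ?_, Or.inl ?_⟩
  · by_cases hz : z ∈ S
    · refine ⟨S ∩ {y, z}, Set.inter_subset_left, ?_, (isThin_triple (y := x) hyw').mono ?_, ?_⟩
      · have : G.IsClique {y, z} := by
          rintro a (rfl | rfl) b (rfl | rfl) hab <;> simp_all [G.adj_comm]
        exact this.subset Set.inter_subset_right
      · rintro a ⟨rfl | rfl | rfl | rfl, ha⟩ <;> simp_all
      · rintro a ⟨ha, ha'⟩ b ⟨hb, hb'⟩
        rcases hmem a ha with rfl | rfl | rfl <;> rcases hmem b hb with rfl | rfl | rfl <;>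
          simp_all
    by_cases hy : y ∈ S
    · refine ⟨{y}, by simpa using hy, by simp, (isThin_triple (y := w) hxz').mono ?_, ?_⟩
      · rintro a ⟨rfl | rfl | rfl | rfl, ha⟩ <;> simp_all
      · rintro a ⟨ha, ha'⟩ b ⟨hb, hb'⟩
        rcases hmem a ha with rfl | rfl | rfl <;> rcases hmem b hb with rfl | rfl | rfl <;>
          simp_all
    · have hSw : S = {w} := by
        obtain ⟨a, ha⟩ := hne
        ext b
        constructor
        · intro hb
          rcases hmem b hb with rfl | rfl | rfl <;> simp_all
        · rintro rfl
          rcases hmem a ha with rfl | rfl | rfl <;> simp_all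
      subst hSw
      refine ⟨{w}, subset_rfl, by simp, (isThin_triple (y := y) hxz').mono ?_, by simp⟩
      rintro a ⟨rfl | rfl | rfl | rfl, ha⟩ <;> simp_all
  · by_cases hz : z ∈ S
    · by_cases hy : y ∈ S
      · exact Or.inl (Or.inl ⟨y, hy, z, hz, hyz⟩)
      by_cases hw : w ∈ S
      · exact Or.inl (Or.inl ⟨z, hz, w, hw, hzw⟩)
      · exact Or.inr (Or.inr ⟨z, hz, y, ⟨by simp, hy⟩, x, ⟨by simp, hx⟩, w, ⟨by simp, hw⟩,
          hyz.symm, hxy.symm, hwx.symm, hzw, hxz.symm, hyw, hzx', hyw'⟩)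
    by_cases hy : y ∈ S
    · by_cases hw : w ∈ S
      · exact Or.inl (Or.inr ⟨y, hy, w, hw, x, ⟨by simp, hx⟩, hyw, hyw', hxy.symm, hwx⟩)
      · exact Or.inr (Or.inr ⟨y, hy, x, ⟨by simp, hx⟩, w, ⟨by simp, hw⟩, z, ⟨by simp, hz⟩,
          hxy.symm, hwx.symm, hzw.symm, hyz, hyw, hxz, hyw', hxz'⟩)
    · have hw : w ∈ S := by
        obtain ⟨a, ha⟩ := hne
        rcases hmem a ha with rfl | rfl | rfl <;> simp_all
      exact Or.inr (Or.inr ⟨w, hw, x, ⟨by simp, hx⟩, y, ⟨by simp, hy⟩, z, ⟨by simp, hz⟩,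
          hwx, hxy, hyz, hzw.symm, hyw.symm, hxz, hwy', hxz'⟩)

/-- Rotation moves an unmarked vertex to the first place. With all four marked, every clique leaves
two marks, which is why `IsSimple` allows this set as an exception. -/
theorem isSimple_fourCycle {x y z w : V} {S : Set V} (hxy : G.Adj x y)
    (hyz : G.Adj y z) (hzw : G.Adj z w) (hwx : G.Adj w x) (hxz : x ≠ z) (hyw : y ≠ w)
    (hxz' : ¬ G.Adj x z) (hyw' : ¬ G.Adj y w) (hS : S ⊆ {x, y, z, w}) (hne : S.Nonempty) :
    IsSimple G {x, y, z, w} S := by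
  have hwy' : ¬ G.Adj w y := fun h => hyw' h.symm
  have hzx' : ¬ G.Adj z x := fun h => hxz' h.symm
  by_cases hx : x ∈ S
  swap
  · exact isSimple_fourCycle_of_notMem hxy hyz hzw hwx hxz hyw hxz' hyw' hS hne hx
  by_cases hy : y ∈ S
  swap
  · have : ({x, y, z, w} : Set V) = {y, z, w, x} := by ext; simp; tauto
    rw [this] at hS ⊢
    exact isSimple_fourCycle_of_notMem hyz hzw hwx hxy hyw hxz.symm hyw' hzx' hS hne hy
  by_cases hz : z ∈ S
  swap
  · have : ({x, y, z, w} : Set V) = {z, w, x, y} := by ext; simp; tauto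
    rw [this] at hS ⊢
    exact isSimple_fourCycle_of_notMem hzw hwx hxy hyz hxz.symm hyw.symm hzx' hwy' hS hne hz
  by_cases hw : w ∈ S
  swap
  · have : ({x, y, z, w} : Set V) = {w, x, y, z} := by ext; simp; tauto
    rw [this] at hS ⊢
    exact isSimple_fourCycle_of_notMem hwx hxy hyz hzw hyw.symm hxz hwy' hxz' hS hne hw
  have hSA : S = {x, y, z, w} := by
    refine hS.antisymm ?_
    rintro a (rfl | rfl | rfl | rfl) <;> assumption
  exact ⟨hS, Or.inr ⟨hSA, x, y, z, w, rfl, hxy, hyz, hzw, hwx, hxz, hyw, hxz', hyw'⟩,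
    Or.inl (Or.inl (Or.inl ⟨x, hx, y, hy, hxy⟩))⟩

theorem IsShortCycle.isSimple {C S : Set V} (hC : IsShortCycle G C) (hS : S ⊆ C)
    (hne : S.Nonempty) : IsSimple G C S := by
  rcases hC with ⟨x, y, z, rfl, hxy, hyz, hxz⟩ |
    ⟨x, y, z, w, rfl, hxy, hyz, hzw, hwx, hxz, hyw, hxz', hyw'⟩
  · obtain ⟨a, ha⟩ := hne
    rcases hS ha with rfl | rfl | rfl
    · exact isSimple_triangle hxy hyz hxz hS ha
    · have : ({x, a, z} : Set V) = {a, x, z} := by ext; simp; tauto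
      rw [this] at hS ⊢
      exact isSimple_triangle hxy.symm hxz hyz hS ha
    · have : ({x, y, a} : Set V) = {a, x, y} := by ext; simp; tauto
      rw [this] at hS ⊢
      exact isSimple_triangle hxz.symm hxy hyz.symm hS ha
  · exact isSimple_fourCycle hxy hyz hzw hwx hxz hyw hxz' hyw' hS hne

theorem IsSimple.exists_transversal {A S : Set V} (h : IsSimple G A S) :
    ∃ T ⊆ S, G.IsClique T ∧ IsThin G (A \ T) := by
  rcases h.transversal with ⟨T, hT, hc, ht, -⟩ |
    ⟨rfl, a, b, c, d, rfl, hab, hbc, hcd, hda, hac, hbd, hac', hbd'⟩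
  · exact ⟨T, hT, hc, ht⟩
  · refine ⟨{a, b}, by intro x; simp; tauto, ?_, (isThin_pair c d).mono ?_⟩
    · rintro u (rfl | rfl) v (rfl | rfl) huv <;> simp_all [G.adj_comm]
    · rintro u ⟨rfl | rfl | rfl | rfl, hu⟩ <;> simp_all

theorem IsSimple.isThin_sdiff {A S : Set V} (h : IsSimple G A S) : IsThin G (A \ S) := by
  obtain ⟨T, hT, -, ht⟩ := h.exists_transversal
  exact ht.mono (Set.sdiff_subset_sdiff_right hT)

/-! ### Two sets joined along marked vertices -/

/-- The disjoint sets `A` and `B` are joined exactly along their marked subsets `S` and `R`. -/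
structure IsJoin (G : SimpleGraph V) (A S B R : Set V) : Prop where
  disjoint : Disjoint A B
  subset_left : S ⊆ A
  subset_right : R ⊆ B
  adj_iff : ∀ a ∈ A, ∀ b ∈ B, G.Adj a b ↔ a ∈ S ∧ b ∈ R

theorem isClique_union {S T : Set V} (hS : G.IsClique S) (hT : G.IsClique T)
    (h : ∀ a ∈ S, ∀ b ∈ T, G.Adj a b) : G.IsClique (S ∪ T) := by
  rintro a (ha | ha) b (hb | hb) hne
  · exact hS ha hb hne
  · exact h a ha b hb
  · exact (h b hb a ha).symm
  · exact hT ha hb hne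

/-- A set without clique cycle-transversal all of whose proper subsets have one. -/
structure IsMinimalBad (G : SimpleGraph V) (U : Set V) : Prop where
  not_hasCCT : ¬ HasCCT G U
  hasCCT : ∀ W ⊆ U, W ≠ U → HasCCT G W

namespace IsJoin

variable {A S B R : Set V}

theorem symm (h : IsJoin G A S B R) : IsJoin G B R A S :=
  ⟨h.disjoint.symm, h.subset_right, h.subset_left, fun b hb a ha => by
    rw [G.adj_comm, h.adj_iff a ha b hb, and_comm]⟩

/-- Cliques in the two marked sets together form a transversal if at most one marked vertex
remains on one side and the remaining marked vertices of the other side are not linked. -/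
theorem exists_transversal (h : IsJoin G A S B R) {T T' : Set V} (hT : T ⊆ S) (hT' : T' ⊆ R)
    (hc : G.IsClique T) (hc' : G.IsClique T') (ht : IsThin G (A \ T)) (ht' : IsThin G (B \ T'))
    (hS : (S \ T).Subsingleton) (hR : IsUnlinked G (B \ T') R) :
    ∃ K ⊆ S ∪ R, G.IsClique K ∧ IsThin G ((A ∪ B) \ K) := by
  refine ⟨T ∪ T', Set.union_subset_union hT hT', isClique_union hc hc' fun a ha b hb =>
    (h.adj_iff a (h.subset_left (hT ha)) b (h.subset_right (hT' hb))).2 ⟨hT ha, hT' hb⟩, ?_⟩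
  have := ht.union (S := S) (R := R) ht' (Set.disjoint_of_subset Set.sdiff_subset
    Set.sdiff_subset h.disjoint) (fun a ha b hb hab => (h.adj_iff a ha.1 b hb.1).1 hab)
    (hS.anti fun x hx => ⟨hx.1, hx.2.2⟩) hR
  refine this.mono ?_
  rintro x ⟨hx | hx, hx'⟩
  · exact Or.inl ⟨hx, fun h => hx' (Or.inl h)⟩
  · exact Or.inr ⟨hx, fun h => hx' (Or.inr h)⟩

/-- A marked set that is a clique together with a transversal on the other side. -/
theorem exists_transversal_of_isClique (h : IsJoin G A S B R) (hS : G.IsClique S)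
    (ht : IsThin G (A \ S)) (hB : ∃ T ⊆ R, G.IsClique T ∧ IsThin G (B \ T)) :
    ∃ K ⊆ S ∪ R, G.IsClique K ∧ IsThin G ((A ∪ B) \ K) := by
  obtain ⟨T, hT, hc, ht'⟩ := hB
  refine ⟨S ∪ T, Set.union_subset_union_right S hT, isClique_union hS hc fun a ha b hb =>
    (h.adj_iff a (h.subset_left ha) b (h.subset_right (hT hb))).2 ⟨ha, hT hb⟩, ?_⟩
  have := ht.union_of_not_adj ht' (Set.disjoint_of_subset Set.sdiff_subset
    Set.sdiff_subset h.disjoint) fun a ha b hb hab => ha.2 ((h.adj_iff a ha.1 b hb.1).1 hab).1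
  refine this.mono ?_
  rintro x ⟨hx | hx, hx'⟩
  · exact Or.inl ⟨hx, fun h => hx' (Or.inl h)⟩
  · exact Or.inr ⟨hx, fun h => hx' (Or.inr h)⟩

theorem hasCCT_of_exists (h : IsJoin G A S B R)
    (hK : ∃ K ⊆ S ∪ R, G.IsClique K ∧ IsThin G ((A ∪ B) \ K)) : HasCCT G (A ∪ B) := by
  obtain ⟨K, hK, hc⟩ := hK
  exact ⟨K, hK.trans (Set.union_subset_union h.subset_left h.subset_right), hc⟩

theorem inter_of_adj (h : IsJoin G A S B R) {T : Set V} (hT : G.IsClique T) {a : V}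
    (haT : a ∈ T) (haA : a ∈ A) : T ∩ B ⊆ R := by
  rintro b ⟨hbT, hbB⟩
  exact ((h.adj_iff a haA b hbB).1 (hT haT hbT (h.disjoint.ne_of_mem haA hbB))).2

theorem eq_of_union_eq (h : IsJoin G A S B R) {E : Set V} (hE : E ⊆ A) (hEA : E ∪ B = A ∪ B) :
    A = E := by
  refine (Set.Subset.antisymm hE ?_).symm
  intro a ha
  have : a ∈ E ∪ B := hEA ▸ Or.inl ha
  rcases this with h' | h'
  · exact h'
  · exact absurd rfl (h.disjoint.ne_of_mem ha h')

/-- If no clique of marked vertices of `B` makes `B` thin, then in a minimal bad set the set `A`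
is as small as it can be while still hindering the cliques of `B`. -/
theorem eq_of_no_transversal (h : IsJoin G A S B R) (hU : IsMinimalBad G (A ∪ B)) {E : Set V}
    (hE : E ⊆ A) (hno : ∀ T ⊆ R, G.IsClique T → ¬ IsThin G (B \ T))
    (hB : ∀ T ⊆ B, G.IsClique T → ¬ IsThin G (E ∪ B \ T)) : A = E := by
  refine h.eq_of_union_eq hE ?_
  by_contra hne
  obtain ⟨T, hTU, hT, ht⟩ := hU.hasCCT _ (Set.union_subset_union_left B hE) hne
  have htB : IsThin G (B \ (T ∩ B)) := ht.mono fun x hx =>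
    ⟨Or.inr hx.1, fun hxT => hx.2 ⟨hxT, hx.1⟩⟩
  -- A clique that meets A contains only marked vertices of B, so it cannot make B thin. One inside
  -- B is defeated by E. Hence E ∪ B is already bad, and minimality forces E to be all of A.
  by_cases hTE : ∃ a ∈ T, a ∈ E
  · obtain ⟨a, haT, haE⟩ := hTE
    exact hno _ (h.inter_of_adj hT haT (hE haE)) (hT.subset Set.inter_subset_left) htB
  · push Not at hTE
    have hTB : T ⊆ B := fun x hx => (hTU hx).resolve_left (hTE x hx)
    refine hB T hTB hT (ht.mono ?_)
    rintro x (hx | hx)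
    · exact ⟨Or.inl hx, fun hxT => hTE x hxT hx⟩
    · exact ⟨Or.inr hx.1, hx.2⟩

/-- If every clique of marked vertices that makes `B` thin leaves linked marked vertices, and
every clique that makes `B` thin leaves two marked vertices, then in a minimal bad set `A`
consists of any two nonadjacent marked vertices. -/
theorem eq_pair (h : IsJoin G A S B R) (hU : IsMinimalBad G (A ∪ B)) {s t : V} (hs : s ∈ S)
    (ht : t ∈ S) (hne : s ≠ t) (hst : ¬ G.Adj s t)
    (h1 : ∀ T ⊆ R, G.IsClique T → IsThin G (B \ T) → ¬ IsUnlinked G (B \ T) R)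
    (h2 : ∀ T ⊆ B, G.IsClique T → IsThin G (B \ T) → ¬ (R \ T).Subsingleton) : A = {s, t} := by
  have hsA := h.subset_left hs
  have htA := h.subset_left ht
  have hE : ({s, t} : Set V) ⊆ A := by rintro x (rfl | rfl) <;> assumption
  refine h.eq_of_union_eq hE ?_
  by_contra hne'
  obtain ⟨T, hTU, hT, hthin⟩ := hU.hasCCT _ (Set.union_subset_union_left B hE) hne'
  have htB : IsThin G (B \ (T ∩ B)) := hthin.mono fun x hx =>
    ⟨Or.inr hx.1, fun hxT => hx.2 ⟨hxT, hx.1⟩⟩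
  -- A clique containing one of `s`, `t` misses the other, which closes a triangle or a 4-cycle with
  -- a linked pair of marks left in B.
  have key : ∀ u v : V, u ∈ ({s, t} : Set V) → v ∈ ({s, t} : Set V) → u ≠ v → ¬ G.Adj u v →
      v ∈ S → u ∉ T := by
    intro u v hu hv huv huv' hvS huT
    have hvT : v ∉ T := fun hvT => huv' (hT huT hvT huv)
    have hvF : v ∈ ({s, t} ∪ B) \ T := ⟨Or.inl hv, hvT⟩
    refine h1 _ (h.inter_of_adj hT huT (hE hu)) (hT.subset Set.inter_subset_left) htB ?_
    rintro r ⟨hrB, hrT⟩ hrR r' ⟨hrB', hrT'⟩ hrR' hrr'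
    have hrF : r ∈ ({s, t} ∪ B) \ T := ⟨Or.inr hrB, fun h => hrT ⟨h, hrB⟩⟩
    have hrF' : r' ∈ ({s, t} ∪ B) \ T := ⟨Or.inr hrB', fun h => hrT' ⟨h, hrB'⟩⟩
    have hvr := (h.adj_iff v (hE hv) r hrB).2 ⟨hvS, hrR⟩
    have hvr' := (h.adj_iff v (hE hv) r' hrB').2 ⟨hvS, hrR'⟩
    refine ⟨fun hadj => hthin.1 v hvF r hrF r' hrF' hvr hadj hvr', ?_⟩
    rintro w ⟨hwB, hwT⟩ hrw hwr'
    exact hthin.2 v hvF r hrF w ⟨Or.inr hwB, fun h => hwT ⟨h, hwB⟩⟩ r' hrF'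
      (h.disjoint.ne_of_mem (hE hv) hwB) hrr' hvr hrw hwr' hvr'.symm
  have hsT : s ∉ T := key s t (by simp) (by simp) hne hst ht
  have htT : t ∉ T := key t s (by simp) (by simp) hne.symm (fun h => hst h.symm) hs
  have hTB : T ⊆ B := by
    intro x hx
    rcases hTU hx with (rfl | rfl) | hxB
    · exact absurd hx hsT
    · exact absurd hx htT
    · exact hxB
  -- A clique inside B leaves two marked vertices of B, and these form a 4-cycle with `s` and `t`.
  refine h2 T hTB hT (hthin.mono fun x hx => ⟨Or.inr hx.1, hx.2⟩) ?_
  rintro r ⟨hr, hrT⟩ r' ⟨hr', hrT'⟩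
  by_contra hrr'
  have hrB := h.subset_right hr
  have hrB' := h.subset_right hr'
  exact hthin.2 s ⟨Or.inl (by simp), hsT⟩ r ⟨Or.inr hrB, hrT⟩ t ⟨Or.inl (by simp), htT⟩ r'
    ⟨Or.inr hrB', hrT'⟩ hne hrr' ((h.adj_iff s hsA r hrB).2 ⟨hs, hr⟩)
    ((h.adj_iff t htA r hrB).2 ⟨ht, hr⟩).symm ((h.adj_iff t htA r' hrB').2 ⟨ht, hr'⟩)
    ((h.adj_iff s hsA r' hrB').2 ⟨hs, hr'⟩).symm

/-- The case that no clique of marked vertices makes `B` thin. -/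
theorem isSimple_of_no_transversal (h : IsJoin G A S B R) (hF : IsForbiddenFree G)
    (hU : IsMinimalBad G (A ∪ B)) (hS : S.Nonempty)
    (hno : ∀ T ⊆ R, G.IsClique T → ¬ IsThin G (B \ T)) : IsSimple G A S := by
  by_cases hA : IsThin G A
  swap
  · obtain ⟨C, hCA, hC⟩ := exists_isShortCycle hA
    by_cases hCS : ∃ s ∈ C, s ∈ S
    · have hAC : A = C := h.eq_of_no_transversal hU hCA hno fun T _ _ ht =>
        hC.not_isThin (ht.mono Set.subset_union_left)
      rw [hAC]
      exact hC.isSimple (hAC ▸ h.subset_left) hS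
    -- A cycle without marks has no neighbours in B, so B would be thin and the empty clique would
    -- contradict `hno`.
    · push Not at hCS
      rcases hF.isThin_or_isThin (Set.disjoint_of_subset_left hCA h.disjoint)
        (fun a ha b hb hab => hCS a ha ((h.adj_iff a (hCA ha) b hb).1 hab).1) with h' | h'
      · exact absurd h' hC.not_isThin
      · exact absurd (by simpa using h') (hno ∅ (Set.empty_subset _) (by simp))
  have hall : ∀ T ⊆ B, G.IsClique T → ¬ IsThin G (A ∪ B \ T) := by
    intro T hTB hT ht
    refine hU.not_hasCCT ⟨T, hTB.trans Set.subset_union_right, hT, ht.mono ?_⟩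
    rintro x ⟨hx | hx, hxT⟩
    · exact Or.inl hx
    · exact Or.inr ⟨hx, hxT⟩
  have hdisj : ∀ T, Disjoint A (B \ T) := fun T =>
    Set.disjoint_of_subset_right Set.sdiff_subset h.disjoint
  have hadj : ∀ T, ∀ a ∈ A, ∀ b ∈ B \ T, G.Adj a b → a ∈ S ∧ b ∈ R := fun T a ha b hb hab =>
    (h.adj_iff a ha b hb.1).1 hab
  have hcover : ∀ T ⊆ B, G.IsClique T → IsThin G (B \ T) → ∃ r ∈ R, r ∉ T := by
    intro T hTB hT ht
    by_contra hcon
    push Not at hcon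
    exact hall T hTB hT (hA.union_of_not_adj ht (hdisj T)
      fun a ha b hb hab => hb.2 (hcon b (hadj T a ha b hb hab).2))
  by_cases hlink : IsUnlinked G A S
  · rcases S.subsingleton_or_nontrivial with hs | ⟨s, hs, t, ht, hne⟩
    · obtain ⟨s, hs'⟩ := hS
      have hSs : S = {s} := hs.eq_singleton_of_mem hs'
      have hsA := h.subset_left hs'
      have hAs : A = {s} := by
        refine h.eq_of_no_transversal hU (by simpa using hsA) hno fun T hTB hT ht => ?_
        -- The vertex `s` sees every mark of B, so thinness of {s} ∪ (B \ T) says that the marks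
        -- left in B are unlinked. Since A has no other mark, A ∪ (B \ T) would be thin too.
        refine hall T hTB hT (hA.union (ht.mono Set.subset_union_right) (hdisj T) (hadj T)
          (hs.anti Set.inter_subset_left) ?_)
        rintro r ⟨hrB, hrT⟩ hrR r' ⟨hrB', hrT'⟩ hrR' hrr'
        have hsr := (h.adj_iff s hsA r hrB).2 ⟨hs', hrR⟩
        have hsr' := (h.adj_iff s hsA r' hrB').2 ⟨hs', hrR'⟩
        refine ⟨fun hadj => ht.1 s (Or.inl rfl) r (Or.inr ⟨hrB, hrT⟩) r' (Or.inr ⟨hrB', hrT'⟩)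
          hsr hadj hsr', fun w hw hrw hwr' => ?_⟩
        exact ht.2 s (Or.inl rfl) r (Or.inr ⟨hrB, hrT⟩) w (Or.inr hw) r' (Or.inr ⟨hrB', hrT'⟩)
          (h.disjoint.ne_of_mem hsA hw.1) hrr' hsr hrw hwr' hsr'.symm
      rw [hAs, hSs]
      exact isSimple_singleton s
    · have hst := (hlink s (h.subset_left hs) hs t (h.subset_left ht) ht hne).1
      have hAst : A = {s, t} := h.eq_pair hU hs ht hne hst
        (fun T hTR hT ht' => absurd ht' (hno T hTR hT)) fun T hTB hT ht' hsub => by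
          refine hall T hTB hT ?_
          rw [Set.union_comm]
          exact ht'.union hA (hdisj T).symm (fun b hb a ha hab => (hadj T a ha b hb hab.symm).symm)
            (hsub.anti fun x hx => ⟨hx.1, hx.2.2⟩) hlink
      have hSst : S = {s, t} := by
        refine Set.Subset.antisymm (hAst ▸ h.subset_left) ?_
        rintro x (rfl | rfl) <;> assumption
      rw [hAst, hSst]
      exact isSimple_nonadjacent hst
  -- A clique inside B that makes B thin leaves some mark `r` of B. So a part E of A that fails to
  -- be thin together with any new vertex seeing all its marks is already all of A.
  · have hE : ∀ E ⊆ A, (∀ r, (∀ s ∈ E, s ∈ S → G.Adj s r) → r ∉ E → ¬ IsThin G (E ∪ {r})) →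
        A = E := by
      intro E hEA hEr
      refine h.eq_of_no_transversal hU hEA hno fun T hTB hT ht => ?_
      obtain ⟨r, hr, hrT⟩ := hcover T hTB hT (ht.mono Set.subset_union_right)
      have hrB := h.subset_right hr
      refine hEr r (fun s hs hsS => (h.adj_iff s (hEA hs) r hrB).2 ⟨hsS, hr⟩)
        (fun hrE => absurd rfl (h.disjoint.ne_of_mem (hEA hrE) hrB)) (ht.mono ?_)
      exact Set.union_subset_union_right E (by simpa using ⟨hrB, hrT⟩)
    unfold IsUnlinked at hlink
    push Not at hlink
    obtain ⟨s, hsA, hs, t, htA, ht, hne, hst⟩ := hlink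
    by_cases hadj' : G.Adj s t
    · have hAst : A = {s, t} := by
        refine hE _ (by rintro x (rfl | rfl) <;> assumption) fun r hr _ hthin => ?_
        exact hthin.1 s (by simp) t (by simp) r (by simp) hadj' (hr t (by simp) ht)
          (hr s (by simp) hs)
      have hSst : S = {s, t} := by
        refine Set.Subset.antisymm (hAst ▸ h.subset_left) ?_
        rintro x (rfl | rfl) <;> assumption
      rw [hAst, hSst]
      exact isSimple_adjacent hadj'
    · obtain ⟨w, hwA, hsw, hwt⟩ := hst hadj'
      by_cases hw : w ∈ S
      · have hAst : A = {s, w} := by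
          refine hE _ (by rintro x (rfl | rfl) <;> assumption) fun r hr _ hthin => ?_
          exact hthin.1 s (by simp) w (by simp) r (by simp) hsw (hr w (by simp) hw)
            (hr s (by simp) hs)
        rw [hAst] at htA
        rcases htA with rfl | rfl
        · exact absurd rfl hne
        · exact absurd hsw hadj'
      · have hAst : A = {s, t, w} := by
          refine hE _ (by rintro x (rfl | rfl | rfl) <;> assumption) fun r hr hrE hthin => ?_
          exact hthin.2 s (by simp) w (by simp) t (by simp) r (by simp) hne
            (fun hwr => hrE (by simp [hwr])) hsw hwt (hr t (by simp) ht) (hr s (by simp) hs).symm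
        have hSst : S = {s, t} := by
          refine Set.Subset.antisymm ?_ ?_
          · intro x hx
            have hxA := h.subset_left hx
            rw [hAst] at hxA
            rcases hxA with rfl | rfl | rfl
            · simp
            · simp
            · exact absurd hx hw
          · rintro x (rfl | rfl) <;> assumption
        rw [hAst, hSst]
        exact isSimple_cherry hadj' hne hsw hwt.symm

end IsJoin

/-! ### Three pairwise nonadjacent marked vertices -/

/-- If every clique of marked vertices that makes `B` thin leaves two marked vertices, then so does
every clique in `B` that makes it thin. -/
theorem not_subsingleton_sdiff {B R T₀ : Set V} (hT₀ : T₀ ⊆ R) (hc₀ : G.IsClique T₀)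
    (ht₀ : IsThin G (B \ T₀)) (hRB : R ⊆ B)
    (hall : ∀ T ⊆ R, G.IsClique T → IsThin G (B \ T) → ¬ (R \ T).Subsingleton) :
    ∀ T ⊆ B, G.IsClique T → IsThin G (B \ T) → ¬ (R \ T).Subsingleton := by
  intro T hT hc ht hsub
  by_cases hTR : T ⊆ R
  · exact hall T hTR hc ht hsub
  obtain ⟨n, hnT, hnR⟩ := Set.not_subset.1 hTR
  obtain ⟨a, ha, b, hb, hne⟩ := Set.not_subsingleton_iff.1 (hall T₀ hT₀ hc₀ ht₀)
  -- If `a` were missing from T, it would be the only missing mark, so T₀ ⊆ T and T ∩ R would leave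
  -- at most one mark. Hence T contains two marks outside T₀ besides the unmarked `n`: a triangle
  -- that T₀ avoids.
  have key : ∀ a ∈ R \ T₀, a ∈ T := by
    intro a ha
    by_contra haT
    have hT₀T : T₀ ⊆ T := by
      intro x hx
      by_contra hxT
      exact ha.2 (hsub ⟨hT₀ hx, hxT⟩ ⟨ha.1, haT⟩ ▸ hx)
    refine hall (T ∩ R) Set.inter_subset_right (hc.subset Set.inter_subset_left)
      (ht₀.mono (Set.sdiff_subset_sdiff_right fun x hx => ⟨hT₀T hx, hT₀ hx⟩))
      (hsub.anti fun x hx => ⟨hx.1, fun h => hx.2 ⟨h, hx.1⟩⟩)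
  have hnA : n ∉ T₀ := fun h => hnR (hT₀ h)
  have haT := key a ha
  have hbT := key b hb
  have hna : n ≠ a := by rintro rfl; exact hnR ha.1
  have hnb : n ≠ b := by rintro rfl; exact hnR hb.1
  exact ht₀.1 n ⟨hT hnT, hnA⟩ a ⟨hRB ha.1, ha.2⟩ b ⟨hRB hb.1, hb.2⟩ (hc hnT haT hna)
    (hc haT hbT hne) (hc hnT hbT hnb)

/-- The vertices of a triangle or an induced 4-cycle are at distance at most two. -/
theorem IsShortCycle.adj_or_exists {C : Set V} (h : IsShortCycle G C) {s c : V} (hs : s ∈ C)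
    (hc : c ∈ C) (hne : s ≠ c) :
    G.Adj s c ∨ ¬ G.Adj s c ∧ ∃ x ∈ C, G.Adj s x ∧ G.Adj x c := by
  by_cases hsc : G.Adj s c
  · exact Or.inl hsc
  refine Or.inr ⟨hsc, ?_⟩
  rcases h with ⟨x, y, z, rfl, hxy, hyz, hxz⟩ |
    ⟨x, y, z, w, rfl, hxy, hyz, hzw, hwx, -, -, -, -⟩
  · rcases hs with rfl | rfl | rfl <;> rcases hc with rfl | rfl | rfl <;>
      simp_all [G.adj_comm]
  · rcases hs with rfl | rfl | rfl | rfl <;> rcases hc with rfl | rfl | rfl | rfl <;>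
      simp_all [G.adj_comm]

/-- The common neighbours of two nonadjacent vertices do not contain two disjoint pairs of
nonadjacent vertices joined by two disjoint edges. -/
theorem false_of_disjoint_pairs (hG : IsDistanceHereditary G) (hF : IsForbiddenFree G)
    {p q a b c d : V} (hpq : p ≠ q ∧ ¬ G.Adj p q)
    (hp : G.Adj p a ∧ G.Adj p b ∧ G.Adj p c ∧ G.Adj p d)
    (hq : G.Adj q a ∧ G.Adj q b ∧ G.Adj q c ∧ G.Adj q d)
    (hab : a ≠ b ∧ ¬ G.Adj a b) (hcd : c ≠ d ∧ ¬ G.Adj c d) (hac : G.Adj a c)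
    (hbd : G.Adj b d) (had' : a ≠ d) (hbc' : b ≠ c) : False := by
  have hba : ¬ G.Adj b a := fun h => hab.2 h.symm
  have hdc : ¬ G.Adj d c := fun h => hcd.2 h.symm
  -- With both further edges present, `p` and `q` complete an octahedron; with one, there is an
  -- induced path whose ends see `p`; with none, two separate edges in the common neighbourhood give
  -- `G5`.
  by_cases had : G.Adj a d
  · by_cases hbc : G.Adj b c
    · exact hF.no_octahedron hpq hab hcd hp hq ⟨hac, had⟩ ⟨hbc, hbd⟩
    · exact hG.no_path_four hbd had.symm hac hba hbc hdc hp.2.1.symm hp.2.2.1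
  · by_cases hbc : G.Adj b c
    · exact hG.no_path_four hac hbc.symm hbd hab.2 had hcd.2 hp.1.symm hp.2.2.2
    · have : AreAttached G p q {a, c} {a, c} {b, d} {b, d} := by
        refine ⟨hpq.1, hpq.2, subset_rfl, subset_rfl, ?_, ?_, ?_, ?_, ?_, ?_⟩
        · simp [hp.1.ne, hp.2.2.1.ne, hq.1.ne, hq.2.2.1.ne]
        · simp [hp.2.1.ne, hp.2.2.2.ne, hq.2.1.ne, hq.2.2.2.ne]
        · rintro x (rfl | rfl) <;> simp [hp, hq]
        · rintro x (rfl | rfl) <;> simp [hp, hq]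
        · rw [Set.disjoint_left]
          rintro x (rfl | rfl) (rfl | rfl)
          · exact hab.1 rfl
          · exact had' rfl
          · exact hbc' rfl
          · exact hcd.1 rfl
        · rintro x (rfl | rfl) y (rfl | rfl)
          · exact hab.2
          · exact had
          · exact fun h => hbc h.symm
          · exact hcd.2
      exact this.false_of_hasLink hF (Or.inl (Or.inl ⟨a, by simp, c, by simp, hac⟩))
        (Or.inl (Or.inl ⟨b, by simp, d, by simp, hbd⟩))

/-- The common neighbourhood of two nonadjacent vertices contains three pairwise nonadjacent
vertices, or becomes a clique when one vertex is removed. -/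
theorem exists_independent_or_isClique (hG : IsDistanceHereditary G) (hF : IsForbiddenFree G)
    {p q : V} {S : Set V} (hpq : p ≠ q ∧ ¬ G.Adj p q) (hp : ∀ s ∈ S, G.Adj p s)
    (hq : ∀ s ∈ S, G.Adj q s) (hS : ¬ G.IsClique S) :
    (∃ a ∈ S, ∃ b ∈ S, ∃ c ∈ S, (a ≠ b ∧ ¬ G.Adj a b) ∧ (a ≠ c ∧ ¬ G.Adj a c) ∧
      (b ≠ c ∧ ¬ G.Adj b c)) ∨ ∃ s ∈ S, G.IsClique (S \ {s}) := by
  by_contra hcon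
  push Not at hcon
  obtain ⟨hno, hclique⟩ := hcon
  have hpair : ∀ T : Set V, ¬ G.IsClique T → ∃ a ∈ T, ∃ b ∈ T, a ≠ b ∧ ¬ G.Adj a b := by
    intro T hT
    by_contra hcon
    push Not at hcon
    exact hT fun a ha b hb hab => hcon a ha b hb hab
  have hsym : ∀ a b, a ≠ b ∧ ¬ G.Adj a b → b ≠ a ∧ ¬ G.Adj b a :=
    fun a b h => ⟨h.1.symm, fun h' => h.2 h'.symm⟩
  have hno' : ∀ a ∈ S, ∀ b ∈ S, ∀ c ∈ S, a ≠ b ∧ ¬ G.Adj a b → a ≠ c → ¬ G.Adj a c → b ≠ c →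
      G.Adj b c := fun a ha b hb c hc hab hac hac' hbc => hno a ha b hb c hc hab ⟨hac, hac'⟩ hbc
  -- In the complement of S any two edges meet. A graph with this property and without triangles is
  -- a star, and removing its centre makes S a clique.
  have hmatch : ∀ a ∈ S, ∀ b ∈ S, ∀ c ∈ S, ∀ d ∈ S, a ≠ b ∧ ¬ G.Adj a b → c ≠ d ∧ ¬ G.Adj c d →
      a ≠ c → a ≠ d → b ≠ c → b ≠ d → False := by
    intro a ha b hb c hc d hd hab hcd hac had hbc hbd
    have hp' : ∀ s ∈ S, G.Adj p s ∧ G.Adj q s := fun s hs => ⟨hp s hs, hq s hs⟩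
    have aux := fun a b c d => @false_of_disjoint_pairs V G hG hF p q a b c d hpq
    by_cases h1 : G.Adj a c ∧ G.Adj b d
    · exact aux a b c d ⟨hp a ha, hp b hb, hp c hc, hp d hd⟩
        ⟨hq a ha, hq b hb, hq c hc, hq d hd⟩ hab hcd h1.1 h1.2 had hbc
    · have h2 : G.Adj a d ∧ G.Adj b c := by
        by_cases hac' : G.Adj a c
        · have hbd' : ¬ G.Adj b d := fun h => h1 ⟨hac', h⟩
          exact ⟨hno' b hb a ha d hd (hsym _ _ hab) hbd hbd' had,
            (hno' d hd c hc b hb (hsym _ _ hcd) hbd.symm (fun h => hbd' h.symm) hbc.symm).symm⟩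
        · exact ⟨(hno' c hc d hd a ha hcd hac.symm (fun h => hac' h.symm) had.symm).symm,
            hno' a ha b hb c hc hab hac hac' hbc⟩
      exact aux a b d c ⟨hp a ha, hp b hb, hp d hd, hp c hc⟩
        ⟨hq a ha, hq b hb, hq d hd, hq c hc⟩ hab (hsym _ _ hcd) h2.1 h2.2 hac hbd
  obtain ⟨s, hs, t, ht, hst⟩ := hpair S hS
  have hthird : ∀ s ∈ S, ∀ t ∈ S, s ≠ t ∧ ¬ G.Adj s t →
      ∃ u ∈ S, u ≠ s ∧ u ≠ t ∧ ¬ G.Adj t u := by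
    intro s hs t ht hst
    obtain ⟨u, hu, v, hv, huv⟩ := hpair _ (hclique s hs)
    by_cases hut : u = t
    · subst hut
      exact ⟨v, hv.1, hv.2, huv.1.symm, huv.2⟩
    by_cases hvt : v = t
    · subst hvt
      exact ⟨u, hu.1, hu.2, hut, fun h => huv.2 h.symm⟩
    · exact absurd (hmatch s hs t ht u hu.1 v hv.1 hst huv (Ne.symm hu.2) (Ne.symm hv.2)
        (Ne.symm hut) (Ne.symm hvt)) id
  obtain ⟨u, hu, hus, hut, htu⟩ := hthird s hs t ht hst
  obtain ⟨v, hv, hvt, hvs, hsv⟩ := hthird t ht s hs (hsym _ _ hst)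
  by_cases huv : u = v
  · subst huv
    exact htu (hno' s hs t ht u hu hst hus.symm hsv hut.symm)
  · exact hmatch t ht u hu s hs v hv ⟨hut.symm, htu⟩ ⟨hvs.symm, hsv⟩ hst.1.symm hvt.symm hus huv

/-- If no clique of marked vertices that makes `A` thin contains all but one marked vertex, then
there are three pairwise nonadjacent marked vertices. -/
theorem exists_independent (hG : IsDistanceHereditary G) (hF : IsForbiddenFree G)
    {A S T₀ : Set V} {p q : V} (hpq : p ≠ q ∧ ¬ G.Adj p q) (hSA : S ⊆ A) (hpA : p ∉ A)
    (hqA : q ∉ A) (hp : ∀ a ∈ A, G.Adj p a ↔ a ∈ S) (hq : ∀ a ∈ A, G.Adj q a ↔ a ∈ S)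
    (hT₀ : T₀ ⊆ S) (hc₀ : G.IsClique T₀) (ht₀ : IsThin G (A \ T₀))
    (hall : ∀ T ⊆ S, G.IsClique T → IsThin G (A \ T) → ¬ (S \ T).Subsingleton) :
    ∃ a ∈ S, ∃ b ∈ S, ∃ c ∈ S, (a ≠ b ∧ ¬ G.Adj a b) ∧ (a ≠ c ∧ ¬ G.Adj a c) ∧
      (b ≠ c ∧ ¬ G.Adj b c) := by
  have hpS : ∀ s ∈ S, G.Adj p s := fun s hs => (hp s (hSA hs)).2 hs
  have hqS : ∀ s ∈ S, G.Adj q s := fun s hs => (hq s (hSA hs)).2 hs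
  have hSthin : IsThin G (A \ S) := ht₀.mono (Set.sdiff_subset_sdiff_right hT₀)
  have hSc : ¬ G.IsClique S := fun h => hall S subset_rfl h hSthin (by simp)
  refine (exists_independent_or_isClique hG hF hpq hpS hqS hSc).resolve_right ?_
  rintro ⟨s, hs, hK⟩
  -- The clique S \ {s} leaves only one mark, so some short cycle survives it. This cycle passes
  -- through `s` and has no other mark.
  have hKthin : ¬ IsThin G (A \ (S \ {s})) := fun h => hall _ Set.sdiff_subset hK h (by
    rintro x ⟨hx, hx'⟩ y ⟨hy, hy'⟩
    simp_all)
  have hsT₀ : s ∈ T₀ := by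
    by_contra hsT₀
    exact hKthin (ht₀.mono (Set.sdiff_subset_sdiff_right fun x hx =>
      ⟨hT₀ hx, by rintro rfl; exact hsT₀ hx⟩))
  obtain ⟨C, hCA, hC⟩ := exists_isShortCycle hKthin
  have hCS : ∀ c ∈ C, c ≠ s → c ∈ A \ S := fun c hc hcs =>
    ⟨(hCA hc).1, fun h => (hCA hc).2 ⟨h, hcs⟩⟩
  have hsC : s ∈ C := by
    by_contra hsC
    exact hC.not_isThin (hSthin.mono fun c hc => hCS c hc (by rintro rfl; exact hsC hc))
  -- The marks equal or adjacent to `s` form a clique containing T₀, so two marks `k`, `l` remain.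
  -- They are adjacent to each other but not to `s`; the edge and the cycle through `s`, both
  -- attached to `p` and `q`, will contradict the exclusion of two links.
  let T : Set V := {k ∈ S | k = s ∨ G.Adj s k}
  have hTc : G.IsClique T := by
    rintro a ⟨ha, has⟩ b ⟨hb, hbs⟩ hne
    rcases has with rfl | has
    · exact hbs.resolve_left hne.symm
    · rcases hbs with rfl | hbs
      · exact has.symm
      · exact hK ⟨ha, has.ne'⟩ ⟨hb, hbs.ne'⟩ hne
  have hTthin : IsThin G (A \ T) := ht₀.mono (Set.sdiff_subset_sdiff_right fun x hx =>
    ⟨hT₀ hx, or_iff_not_imp_left.2 fun hne => hc₀ hsT₀ hx (Ne.symm hne)⟩)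
  obtain ⟨k, ⟨hk, hkT⟩, l, ⟨hl, hlT⟩, hkl⟩ :=
    Set.not_subsingleton_iff.1 (hall T (fun x hx => hx.1) hTc hTthin)
  have hT' : ∀ x ∈ S, x ∉ T → x ≠ s ∧ ¬ G.Adj s x := fun x hx hxT =>
    ⟨fun h => hxT ⟨hx, Or.inl h⟩, fun h => hxT ⟨hx, Or.inr h⟩⟩
  have hks := hT' k hk hkT
  have hls := hT' l hl hlT
  have hadj : G.Adj k l := hK ⟨hk, hks.1⟩ ⟨hl, hls.1⟩ hkl
  have hnear : ∀ k ∈ S, k ∉ T → ∀ l ∈ S, l ∉ T → G.Adj k l → ∀ x ∈ A \ S, G.Adj s x →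
      ¬ G.Adj k x := by
    intro k hk hkT l hl hlT hadj x hx hsx hkx
    have hxT : x ∉ T := fun h => hx.2 h.1
    by_cases hlx : G.Adj l x
    · exact hTthin.1 k ⟨hSA hk, hkT⟩ l ⟨hSA hl, hlT⟩ x ⟨hx.1, hxT⟩ hadj hlx hkx
    · exact hG.no_path_four hadj.symm hkx hsx.symm hlx (fun h => (hT' l hl hlT).2 h.symm)
        (fun h => (hT' k hk hkT).2 h.symm) (hpS l hl).symm (hpS s hs)
  -- The edge sends nothing to the cycle: neighbours of `s` are excluded by `hnear`, and a vertex at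
  -- distance two would give an induced path from `k` to `s`, whose ends see `p`.
  have hfar : ∀ k ∈ S, k ∉ T → ∀ l ∈ S, l ∉ T → G.Adj k l → ∀ c ∈ C, ¬ G.Adj k c := by
    intro k hk hkT l hl hlT hadj c hc hkc
    have hks := hT' k hk hkT
    by_cases hcs : c = s
    · subst hcs
      exact hks.2 hkc.symm
    rcases hC.adj_or_exists hsC hc (Ne.symm hcs) with hsc | ⟨hsc, x, hx, hsx, hxc⟩
    · exact hnear k hk hkT l hl hlT hadj c (hCS c hc hcs) hsc hkc
    · have hkx := hnear k hk hkT l hl hlT hadj x (hCS x hx hsx.ne') hsx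
      exact hG.no_path_four hkc hxc.symm hsx.symm hkx (fun h => hks.2 h.symm)
        (fun h => hsc h.symm) (hpS k hk).symm (hpS s hs)
  have hkC := hfar k hk hkT l hl hlT hadj
  have hlC := hfar l hl hlT k hk hkT hadj.symm
  have hCmem : ∀ c ∈ C, c ∈ S ↔ c = s := fun c hc =>
    ⟨fun h => by_contra fun hne => (hCS c hc hne).2 h, fun h => h ▸ hs⟩
  have hatt : AreAttached G p q C {s} {k, l} {k, l} := by
    refine ⟨hpq.1, hpq.2, by simpa using hsC, subset_rfl, ⟨fun h => hpA (hCA h).1,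
      fun h => hqA (hCA h).1⟩, ?_, ?_, ?_, ?_, ?_⟩
    · simp [(hpS k hk).ne, (hpS l hl).ne, (hqS k hk).ne, (hqS l hl).ne]
    · intro c hc
      rw [hp c (hCA hc).1, hq c (hCA hc).1, hCmem c hc]
      simp
    · rintro x (rfl | rfl) <;> simp [hpS, hqS, hk, hl]
    · rw [Set.disjoint_right]
      rintro x (rfl | rfl) hx
      · exact hks.1 ((hCmem _ hx).1 hk)
      · exact hls.1 ((hCmem _ hx).1 hl)
    · rintro c hc x (rfl | rfl) h
      · exact hkC c hc h.symm
      · exact hlC c hc h.symm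
  have hlink : HasLink G C {s} := by
    refine (hC.isSimple (by simpa using hsC) (by simp)).link.resolve_right ?_
    rintro ⟨rfl, h⟩
    exact hC.not_isThin (isThin_of_independent h)
  exact hatt.false_of_hasLink hF hlink (Or.inl (Or.inl ⟨k, by simp, l, by simp, hadj⟩))

theorem exists_not_adj {S : Set V} (hS : ¬ G.IsClique S) :
    ∃ a ∈ S, ∃ b ∈ S, a ≠ b ∧ ¬ G.Adj a b := by
  by_contra hcon
  push Not at hcon
  exact hS fun a ha b hb hab => hcon a ha b hb hab

/-! ### One side of a join is simple -/

namespace IsJoin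

variable {A S B R : Set V}

/-- The case that some clique of marked vertices makes `B` thin and some clique makes `A` thin and
leaves at most one marked vertex. -/
theorem isSimple_of_subsingleton (h : IsJoin G A S B R) (hU : IsMinimalBad G (A ∪ B))
    {T T' : Set V} (hT : T ⊆ S) (hc : G.IsClique T) (ht : IsThin G (A \ T))
    (hsub : (S \ T).Subsingleton) (hT' : T' ⊆ R) (hc' : G.IsClique T')
    (ht' : IsThin G (B \ T')) : IsSimple G A S := by
  -- Otherwise all of S could be removed together with T', cutting every edge between the two sides.
  have hS : ¬ G.IsClique S := fun hS => hU.not_hasCCT (h.hasCCT_of_exists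
    (h.exists_transversal_of_isClique hS (ht.mono (Set.sdiff_subset_sdiff_right hT))
      ⟨T', hT', hc', ht'⟩))
  obtain ⟨s, hs, t, ht₂, hne, hst⟩ := exists_not_adj hS
  have h1 : ∀ T ⊆ R, G.IsClique T → IsThin G (B \ T) → ¬ IsUnlinked G (B \ T) R :=
    fun K hK hKc hKt hKu => hU.not_hasCCT (h.hasCCT_of_exists
      (h.exists_transversal hT hK hc hKc ht hKt hsub hKu))
  have hA : A = {s, t} := h.eq_pair hU hs ht₂ hne hst h1
    (not_subsingleton_sdiff hT' hc' ht' h.subset_right fun K hK hKc hKt hKs =>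
      h1 K hK hKc hKt (isUnlinked_of_subsingleton (hKs.anti fun x hx => ⟨hx.1, hx.2.2⟩)))
  have hSst : S = {s, t} := by
    refine Set.Subset.antisymm (hA ▸ h.subset_left) ?_
    rintro x (rfl | rfl) <;> assumption
  rw [hA, hSst]
  exact isSimple_nonadjacent hst

/-- Two nonadjacent vertices of R serve as the two vertices to which A is attached. -/
theorem exists_independent (h : IsJoin G A S B R) (hG : IsDistanceHereditary G)
    (hF : IsForbiddenFree G) {T : Set V} (hT : T ⊆ S) (hc : G.IsClique T)
    (ht : IsThin G (A \ T))
    (hall : ∀ T ⊆ S, G.IsClique T → IsThin G (A \ T) → ¬ (S \ T).Subsingleton)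
    (hR : ¬ G.IsClique R) :
    ∃ a ∈ S, ∃ b ∈ S, ∃ c ∈ S, (a ≠ b ∧ ¬ G.Adj a b) ∧ (a ≠ c ∧ ¬ G.Adj a c) ∧
      (b ≠ c ∧ ¬ G.Adj b c) := by
  obtain ⟨p, hp, q, hq, hpq⟩ := exists_not_adj hR
  have hmem : ∀ p ∈ R, p ∉ A ∧ ∀ a ∈ A, G.Adj p a ↔ a ∈ S := fun p hp =>
    ⟨fun hpA => absurd rfl (h.disjoint.ne_of_mem hpA (h.subset_right hp)), fun a ha => by
      rw [G.adj_comm, h.adj_iff a ha p (h.subset_right hp)]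
      simp [hp]⟩
  exact CliqueCycleTransversal.exists_independent hG hF hpq h.subset_left (hmem p hp).1
    (hmem q hq).1 (hmem p hp).2 (hmem q hq).2 hT hc ht hall

/-- In a minimal bad set one of the two sides of a join is simple. -/
theorem isSimple_or_isSimple (h : IsJoin G A S B R) (hG : IsDistanceHereditary G)
    (hF : IsForbiddenFree G) (hU : IsMinimalBad G (A ∪ B)) (hS : S.Nonempty) (hR : R.Nonempty) :
    IsSimple G A S ∨ IsSimple G B R := by
  have hU' : IsMinimalBad G (B ∪ A) := Set.union_comm A B ▸ hU
  by_cases hB : ∀ T ⊆ R, G.IsClique T → ¬ IsThin G (B \ T)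
  · exact Or.inl (h.isSimple_of_no_transversal hF hU hS hB)
  by_cases hA : ∀ T ⊆ S, G.IsClique T → ¬ IsThin G (A \ T)
  · exact Or.inr (h.symm.isSimple_of_no_transversal hF hU' hR hA)
  push Not at hA hB
  obtain ⟨T, hT, hc, ht⟩ := hA
  obtain ⟨T', hT', hc', ht'⟩ := hB
  by_cases hA' : ∀ T ⊆ S, G.IsClique T → IsThin G (A \ T) → ¬ (S \ T).Subsingleton
  swap
  · push Not at hA'
    obtain ⟨K, hK, hKc, hKt, hKs⟩ := hA'
    exact Or.inl (h.isSimple_of_subsingleton hU hK hKc hKt hKs hT' hc' ht')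
  by_cases hB' : ∀ T ⊆ R, G.IsClique T → IsThin G (B \ T) → ¬ (R \ T).Subsingleton
  swap
  · push Not at hB'
    obtain ⟨K, hK, hKc, hKt, hKs⟩ := hB'
    exact Or.inr (h.symm.isSimple_of_subsingleton hU' hK hKc hKt hKs hT hc ht)
  have hSc : ¬ G.IsClique S := fun hS =>
    hA' S subset_rfl hS (ht.mono (Set.sdiff_subset_sdiff_right hT)) (by simp)
  have hRc : ¬ G.IsClique R := fun hR =>
    hB' R subset_rfl hR (ht'.mono (Set.sdiff_subset_sdiff_right hT')) (by simp)
  obtain ⟨a, ha, b, hb, c, hc₁, hab, hac, hbc⟩ := h.exists_independent hG hF hT hc ht hA' hRc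
  obtain ⟨x, hx, y, hy, z, hz, hxy, hxz, hyz⟩ :=
    h.symm.exists_independent hG hF hT' hc' ht' hB' hSc
  have hadj : ∀ a ∈ S, ∀ x ∈ R, G.Adj a x := fun a ha x hx =>
    (h.adj_iff a (h.subset_left ha) x (h.subset_right hx)).2 ⟨ha, hx⟩
  exact (hF.no_bipartite hab hac hbc hxy hxz hyz ⟨hadj a ha x hx, hadj a ha y hy, hadj a ha z hz⟩
    ⟨hadj b hb x hx, hadj b hb y hy, hadj b hb z hz⟩
    ⟨hadj c hc₁ x hx, hadj c hc₁ y hy, hadj c hc₁ z hz⟩).elim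

end IsJoin

/-! ### Simple sets joined in a star or a triangle -/

theorem IsJoin.adj_of_mem {A S B R : Set V} (h : IsJoin G A S B R) {a b : V} (ha : a ∈ S)
    (hb : b ∈ R) : G.Adj a b :=
  (h.adj_iff a (h.subset_left ha) b (h.subset_right hb)).2 ⟨ha, hb⟩

/-- Two nonadjacent vertices have no induced 4-cycle in their common neighbourhood. -/
theorem IsForbiddenFree.not_isFourCycle (hF : IsForbiddenFree G) {A : Set V} {p q : V}
    (hpq : p ≠ q ∧ ¬ G.Adj p q) (hp : ∀ a ∈ A, G.Adj p a) (hq : ∀ a ∈ A, G.Adj q a) :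
    ¬ IsFourCycle G A := by
  rintro ⟨a, b, c, d, rfl, hab, hbc, hcd, hda, hac, hbd, hac', hbd'⟩
  exact hF.no_octahedron hpq ⟨hac, hac'⟩ ⟨hbd, hbd'⟩
    ⟨hp a (by simp), hp c (by simp), hp b (by simp), hp d (by simp)⟩
    ⟨hq a (by simp), hq c (by simp), hq b (by simp), hq d (by simp)⟩ ⟨hab, hda.symm⟩
    ⟨hbc.symm, hcd⟩

section Star

variable {C Q D₁ S₁ D₂ S₂ : Set V}

theorem IsThin.union_sdiff {T : Set V} (hd : Disjoint D₁ D₂)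
    (hD : ∀ a ∈ D₁, ∀ b ∈ D₂, ¬ G.Adj a b) (h₁ : IsThin G (D₁ \ T)) (h₂ : IsThin G (D₂ \ T)) :
    IsThin G ((D₁ ∪ D₂) \ T) := by
  rw [Set.union_sdiff_distrib]
  exact h₁.union_of_not_adj h₂ (Set.disjoint_of_subset Set.sdiff_subset Set.sdiff_subset hd)
    fun a ha b hb => hD a ha.1 b hb.1

/-- Removing all of Q cuts C off from the leaves, of which only D₁ can still contain short cycles.
-/
theorem IsJoin.hasCCT_star_of_isClique (h : IsJoin G C Q (D₁ ∪ D₂) (S₁ ∪ S₂))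
    (hC : IsSimple G C Q) (h₁ : IsSimple G D₁ S₁) (hd : Disjoint D₁ D₂)
    (hD : ∀ a ∈ D₁, ∀ b ∈ D₂, ¬ G.Adj a b) (hQ : G.IsClique Q) (ht : IsThin G D₂) :
    HasCCT G (C ∪ (D₁ ∪ D₂)) := by
  obtain ⟨T, hT, hc, ht'⟩ := h₁.exists_transversal
  exact h.hasCCT_of_exists (h.exists_transversal_of_isClique hQ hC.isThin_sdiff
    ⟨T, hT.trans Set.subset_union_left, hc, ht'.union_sdiff hd hD (ht.mono Set.sdiff_subset)⟩)

/-- Cliques from C and D₁ each leave at most one mark, and the vertices of D₂ have no neighbours in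
D₁ ∪ D₂, so the marks left there are unlinked. A fully marked 4-cycle as D₁ gives an octahedron with
`p` and `q`; as C it forces the marks of the leaves to form a clique, which can be removed instead.
-/
theorem IsJoin.hasCCT_star_of_independent (h : IsJoin G C Q (D₁ ∪ D₂) (S₁ ∪ S₂))
    (hF : IsForbiddenFree G) (hC : IsSimple G C Q) (h₁ : IsSimple G D₁ S₁)
    (h₂ : IsSimple G D₂ S₂) (hd : Disjoint D₁ D₂)
    (hD : ∀ a ∈ D₁, ∀ b ∈ D₂, ¬ G.Adj a b) {p q : V} (hp : p ∈ Q) (hq : q ∈ Q)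
    (hpq : p ≠ q ∧ ¬ G.Adj p q) (hind : ∀ a ∈ D₂, ∀ b ∈ D₂, ¬ G.Adj a b) :
    HasCCT G (C ∪ (D₁ ∪ D₂)) := by
  have hthin : ∀ T, IsThin G (D₁ \ T) → IsThin G ((D₁ ∪ D₂) \ T) := fun T ht =>
    ht.union_sdiff hd hD ((isThin_of_independent hind).mono Set.sdiff_subset)
  rcases hC.transversal with ⟨T, hT, hTc, hTt, hTs⟩ | ⟨hQC, hC4⟩
  · rcases h₁.transversal with ⟨T', hT', hTc', hTt', hTs'⟩ | ⟨rfl, hD4⟩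
    · refine h.hasCCT_of_exists (h.exists_transversal hT (hT'.trans Set.subset_union_left) hTc hTc'
        hTt (hthin T' hTt') hTs ?_)
      have hno : ∀ a ∈ D₁ ∪ D₂, ∀ b ∈ D₂, ¬ G.Adj a b := by
        rintro a (ha | ha) b hb
        · exact hD a ha b hb
        · exact hind a ha b hb
      have hleft : ∀ x ∈ (D₁ ∪ D₂) \ T', x ∈ S₁ ∪ S₂ → x ∈ D₂ ∨ x ∈ S₁ \ T' := by
        rintro x hx (hx' | hx')
        · exact Or.inr ⟨hx', hx.2⟩
        · exact Or.inl (h₂.subset hx')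
      intro r hr hrS t ht htS hne
      rcases hleft r hr hrS with hr' | hr'
      · exact ⟨fun hrt => hno t ht.1 r hr' hrt.symm, fun w hw hrw => absurd hrw.symm
          (hno w hw.1 r hr')⟩
      rcases hleft t ht htS with ht' | ht'
      · exact ⟨hno r hr.1 t ht', fun w hw _ => hno w hw.1 t ht'⟩
      · exact absurd (hTs' hr' ht') hne
    · exact absurd hD4 (hF.not_isFourCycle hpq (fun a ha => h.adj_of_mem hp (Or.inl ha))
        fun a ha => h.adj_of_mem hq (Or.inl ha))
  · by_cases hS : G.IsClique (S₁ ∪ S₂)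
    · have := h.symm.hasCCT_of_exists (h.symm.exists_transversal_of_isClique hS
        (((hthin S₁ h₁.isThin_sdiff)).mono
          (Set.sdiff_subset_sdiff_right Set.subset_union_left)) hC.exists_transversal)
      rwa [Set.union_comm] at this
    · obtain ⟨u, hu, v, hv, huv⟩ := exists_not_adj hS
      subst hQC
      exact absurd hC4 (hF.not_isFourCycle huv (fun a ha => (h.adj_of_mem ha hu).symm)
        fun a ha => (h.adj_of_mem ha hv).symm)

/-- A simple set joined to two separate simple sets. -/
theorem IsJoin.hasCCT_star (h : IsJoin G C Q (D₁ ∪ D₂) (S₁ ∪ S₂)) (hF : IsForbiddenFree G)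
    (hC : IsSimple G C Q) (h₁ : IsSimple G D₁ S₁) (h₂ : IsSimple G D₂ S₂)
    (hd : Disjoint D₁ D₂) (hD : ∀ a ∈ D₁, ∀ b ∈ D₂, ¬ G.Adj a b) :
    HasCCT G (C ∪ (D₁ ∪ D₂)) := by
  have h' : IsJoin G C Q (D₂ ∪ D₁) (S₂ ∪ S₁) := by
    rwa [Set.union_comm D₂, Set.union_comm S₂]
  have hD' : ∀ a ∈ D₂, ∀ b ∈ D₁, ¬ G.Adj a b := fun a ha b hb hab => hD b hb a ha hab.symm
  by_cases hQ : G.IsClique Q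
  -- Two separate leaves cannot both contain a short cycle, by `G1`, `G2` and `G3`.
  · rcases hF.isThin_or_isThin hd hD with ht | ht
    · have := h'.hasCCT_star_of_isClique hC h₂ hd.symm hD' hQ ht
      rwa [Set.union_comm D₂] at this
    · exact h.hasCCT_star_of_isClique hC h₁ hd hD hQ ht
  obtain ⟨p, hp, q, hq, hpq⟩ := exists_not_adj hQ
  -- Two nonadjacent marks of the centre cannot face links in both leaves, so one leaf is a fully
  -- marked independent set.
  rcases h₂.link with hl₂ | ⟨rfl, hind⟩
  · rcases h₁.link with hl₁ | ⟨rfl, hind⟩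
    · have hnot : ∀ p ∈ Q, p ∉ D₁ ∪ D₂ := fun p hp hpD =>
        absurd rfl (h.disjoint.ne_of_mem (h.subset_left hp) hpD)
      have hadj₁ : ∀ p ∈ Q, ∀ x ∈ D₁, G.Adj p x ↔ x ∈ S₁ := fun p hp x hx => by
        rw [h.adj_iff p (h.subset_left hp) x (Or.inl hx)]
        have : x ∉ S₂ := fun h => absurd rfl (hd.ne_of_mem hx (h₂.subset h))
        simp [hp, this]
      have hadj₂ : ∀ p ∈ Q, ∀ x ∈ D₂, G.Adj p x ↔ x ∈ S₂ := fun p hp x hx => by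
        rw [h.adj_iff p (h.subset_left hp) x (Or.inr hx)]
        have : x ∉ S₁ := fun h => absurd rfl (hd.ne_of_mem (h₁.subset h) hx)
        simp [hp, this]
      have hatt : AreAttached G p q D₁ S₁ D₂ S₂ :=
        ⟨hpq.1, hpq.2, h₁.subset, h₂.subset,
          ⟨fun h => hnot p hp (Or.inl h), fun h => hnot q hq (Or.inl h)⟩,
          ⟨fun h => hnot p hp (Or.inr h), fun h => hnot q hq (Or.inr h)⟩,
          fun x hx => ⟨hadj₁ p hp x hx, hadj₁ q hq x hx⟩,
          fun x hx => ⟨hadj₂ p hp x hx, hadj₂ q hq x hx⟩, hd, hD⟩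
      exact (hatt.false_of_hasLink hF hl₁ hl₂).elim
    · have := h'.hasCCT_star_of_independent hF hC h₂ h₁ hd.symm hD' hp hq hpq hind
      rwa [Set.union_comm D₂] at this
  · exact h.hasCCT_star_of_independent hF hC h₁ h₂ hd hD hp hq hpq hind

end Star

section Triangle

variable {D₁ S₁ D₂ S₂ D₃ S₃ : Set V}

theorem IsJoin.union_left (h₁ : IsJoin G D₁ S₁ D₃ S₃) (h₂ : IsJoin G D₂ S₂ D₃ S₃)
    (hd : Disjoint D₁ D₂) : IsJoin G (D₁ ∪ D₂) (S₁ ∪ S₂) D₃ S₃ := by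
  refine ⟨Set.disjoint_union_left.2 ⟨h₁.disjoint, h₂.disjoint⟩,
    Set.union_subset_union h₁.subset_left h₂.subset_left, h₁.subset_right, ?_⟩
  rintro a (ha | ha) b hb
  · have : a ∉ S₂ := fun h => absurd rfl (hd.ne_of_mem ha (h₂.subset_left h))
    rw [h₁.adj_iff a ha b hb]
    simp [this]
  · have : a ∉ S₁ := fun h => absurd rfl (hd.ne_of_mem (h₁.subset_left h) ha)
    rw [h₂.adj_iff a ha b hb]
    simp [this]

theorem IsJoin.of_union_left (h : IsJoin G (D₁ ∪ D₂) (S₁ ∪ S₂) D₃ S₃) (hd : Disjoint D₁ D₂)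
    (hS₁ : S₁ ⊆ D₁) (hS₂ : S₂ ⊆ D₂) : IsJoin G D₁ S₁ D₃ S₃ := by
  refine ⟨h.disjoint.mono_left Set.subset_union_left, hS₁, h.subset_right, fun a ha b hb => ?_⟩
  have : a ∉ S₂ := fun h => absurd rfl (hd.ne_of_mem ha (hS₂ h))
  rw [h.adj_iff a (Or.inl ha) b hb]
  simp [this]

/-- All of S₃ is removed. Every mark of the other two sets is adjacent to it, so any marked clique
that makes D₁ ∪ D₂ thin can be added. If neither S₁ nor S₂ is a clique, fully marked 4-cycles are
excluded by the octahedron. -/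
theorem IsJoin.hasCCT_triangle_of_isClique (hF : IsForbiddenFree G)
    (h₁₂ : IsJoin G D₁ S₁ D₂ S₂) (h₁₃ : IsJoin G D₁ S₁ D₃ S₃) (h₂₃ : IsJoin G D₂ S₂ D₃ S₃)
    (h₁ : IsSimple G D₁ S₁) (h₂ : IsSimple G D₂ S₂) (h₃ : IsSimple G D₃ S₃)
    (hS : G.IsClique S₃) : HasCCT G (D₁ ∪ D₂ ∪ D₃) := by
  have h := h₁₃.union_left h₂₃ h₁₂.disjoint
  suffices hsuff : ∃ T ⊆ S₁ ∪ S₂, G.IsClique T ∧ IsThin G ((D₁ ∪ D₂) \ T) by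
    have := h.symm.hasCCT_of_exists
      (h.symm.exists_transversal_of_isClique hS h₃.isThin_sdiff hsuff)
    rwa [Set.union_comm] at this
  by_cases hS₁ : G.IsClique S₁
  · exact h₁₂.exists_transversal_of_isClique hS₁ h₁.isThin_sdiff h₂.exists_transversal
  by_cases hS₂ : G.IsClique S₂
  · have := h₁₂.symm.exists_transversal_of_isClique hS₂ h₂.isThin_sdiff h₁.exists_transversal
    rwa [Set.union_comm, Set.union_comm D₂] at this
  obtain ⟨a, ha, b, hb, hab⟩ := exists_not_adj hS₁
  obtain ⟨c, hc, d, hd, hcd⟩ := exists_not_adj hS₂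
  rcases h₁.transversal with ⟨T, hT, hTc, hTt, hTs⟩ | ⟨rfl, h4⟩
  · rcases h₂.transversal with ⟨T', hT', hTc', hTt', hTs'⟩ | ⟨rfl, h4⟩
    · exact h₁₂.exists_transversal hT hT' hTc hTc' hTt hTt' hTs (isUnlinked_of_subsingleton
        (hTs'.anti fun x hx => ⟨hx.1, hx.2.2⟩))
    · exact absurd h4 (hF.not_isFourCycle hab (fun x hx => h₁₂.adj_of_mem ha hx)
        fun x hx => h₁₂.adj_of_mem hb hx)
  · exact absurd h4 (hF.not_isFourCycle hcd (fun x hx => (h₁₂.adj_of_mem hx hc).symm)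
      fun x hx => (h₁₂.adj_of_mem hx hd).symm)

/-- Three pairwise joined simple sets. -/
theorem IsJoin.hasCCT_triangle (hF : IsForbiddenFree G)
    (h₁₂ : IsJoin G D₁ S₁ D₂ S₂) (h₁₃ : IsJoin G D₁ S₁ D₃ S₃) (h₂₃ : IsJoin G D₂ S₂ D₃ S₃)
    (h₁ : IsSimple G D₁ S₁) (h₂ : IsSimple G D₂ S₂) (h₃ : IsSimple G D₃ S₃) :
    HasCCT G (D₁ ∪ D₂ ∪ D₃) := by
  by_cases hS₃ : G.IsClique S₃
  · exact hasCCT_triangle_of_isClique hF h₁₂ h₁₃ h₂₃ h₁ h₂ h₃ hS₃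
  by_cases hS₂ : G.IsClique S₂
  · have := hasCCT_triangle_of_isClique hF h₁₃ h₁₂ h₂₃.symm h₁ h₃ h₂ hS₂
    rwa [Set.union_right_comm] at this
  by_cases hS₁ : G.IsClique S₁
  · have := hasCCT_triangle_of_isClique hF h₂₃ h₁₂.symm h₁₃.symm h₂ h₃ h₁ hS₁
    rwa [Set.union_comm, ← Set.union_assoc] at this
  -- Nonadjacent pairs in all three marked sets form an octahedron.
  obtain ⟨a, ha, b, hb, hab⟩ := exists_not_adj hS₁
  obtain ⟨c, hc, d, hd, hcd⟩ := exists_not_adj hS₂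
  obtain ⟨p, hp, q, hq, hpq⟩ := exists_not_adj hS₃
  exact (hF.no_octahedron hpq hab hcd
    ⟨(h₁₃.adj_of_mem ha hp).symm, (h₁₃.adj_of_mem hb hp).symm, (h₂₃.adj_of_mem hc hp).symm,
      (h₂₃.adj_of_mem hd hp).symm⟩
    ⟨(h₁₃.adj_of_mem ha hq).symm, (h₁₃.adj_of_mem hb hq).symm, (h₂₃.adj_of_mem hc hq).symm,
      (h₂₃.adj_of_mem hd hq).symm⟩
    ⟨h₁₂.adj_of_mem ha hc, h₁₂.adj_of_mem ha hd⟩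
    ⟨h₁₂.adj_of_mem hb hc, h₁₂.adj_of_mem hb hd⟩).elim

end Triangle

/-! ### Minimal bad sets -/

theorem IsComposed.nonempty {A S : Set V} (h : IsComposed G A S) : S.Nonempty := by
  induction h with
  | single v => exact Set.singleton_nonempty v
  | union _ _ _ _ h1 _ => exact h1.mono Set.subset_union_left
  | join _ _ _ _ h1 _ => exact h1.mono Set.subset_union_left
  | attach _ _ _ _ h1 _ => exact h1

/-- Were there no edges between the parts, one part would be thin, and a transversal of the other
part, which exists by minimality, would serve for both. -/
theorem IsMinimalBad.exists_adj {A B : Set V} (hU : IsMinimalBad G (A ∪ B))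
    (hF : IsForbiddenFree G) (hd : Disjoint A B) (hA : A.Nonempty) (hB : B.Nonempty) :
    ∃ a ∈ A, ∃ b ∈ B, G.Adj a b := by
  by_contra hno
  push Not at hno
  have key : ∀ A B : Set V, IsMinimalBad G (A ∪ B) → Disjoint A B → B.Nonempty →
      (∀ a ∈ A, ∀ b ∈ B, ¬ G.Adj a b) → ¬ IsThin G B := by
    intro A B hU hd hB hno ht
    obtain ⟨T, hT, hc, ht'⟩ := hU.hasCCT A Set.subset_union_left fun h => by
      obtain ⟨b, hb⟩ := hB
      have : b ∈ A := h ▸ Or.inr hb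
      exact absurd rfl (hd.ne_of_mem this hb)
    exact hU.not_hasCCT ⟨T, hT.trans Set.subset_union_left, hc,
      ht'.union_sdiff hd hno (ht.mono Set.sdiff_subset)⟩
  rcases hF.isThin_or_isThin hd hno with ht | ht
  · exact key B A (Set.union_comm A B ▸ hU) hd.symm hA (fun b hb a ha h => hno a ha b hb h.symm) ht
  · exact key A B hU hd hB hno ht

/-- A subset of a minimal bad set with a uniform neighbourhood is simple or is joined to a simple
set. -/
theorem IsMinimalBad.isSimple_or_exists_isJoin {U A S : Set V} (hU : IsMinimalBad G U)
    (hG : IsDistanceHereditary G) (hF : IsForbiddenFree G) (hAU : A ⊆ U) (hSA : S ⊆ A)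
    (hS : S.Nonempty)
    (hout : ∀ v ∈ U \ A, (∀ a ∈ A, G.Adj v a ↔ a ∈ S) ∨ ∀ a ∈ A, ¬ G.Adj v a) :
    IsSimple G A S ∨ ∃ B R, IsJoin G A S B R ∧ A ∪ B = U ∧ IsSimple G B R := by
  have hunion : A ∪ U \ A = U := Set.union_sdiff_cancel hAU
  have hjoin : IsJoin G A S (U \ A) {v ∈ U \ A | ∃ a ∈ A, G.Adj v a} := by
    refine ⟨Set.disjoint_sdiff_right, hSA, fun v hv => hv.1, fun a ha b hb => ?_⟩
    constructor
    · intro hab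
      refine ⟨?_, hb, a, ha, hab.symm⟩
      rcases hout b hb with h | h
      · exact (h a ha).1 hab.symm
      · exact absurd hab.symm (h a ha)
    · rintro ⟨haS, -, c, hc, hbc⟩
      rcases hout b hb with h | h
      · exact ((h a ha).2 haS).symm
      · exact absurd hbc (h c hc)
  rcases (U \ A).eq_empty_or_nonempty with hB | hB
  · refine Or.inr ⟨_, _, hjoin, hunion, ?_⟩
    have : {v ∈ U \ A | ∃ a ∈ A, G.Adj v a} = ∅ := Set.subset_empty_iff.1 fun v hv => hB ▸ hv.1
    rw [this, hB]
    exact isSimple_empty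
  · obtain ⟨a, ha, b, hb, hab⟩ :=
      (hunion.symm ▸ hU : IsMinimalBad G (A ∪ U \ A)).exists_adj hF Set.disjoint_sdiff_right
        (hS.mono hSA) hB
    rcases hjoin.isSimple_or_isSimple hG hF (hunion.symm ▸ hU) hS ⟨b, hb, a, ha, hab.symm⟩ with
      h | h
    · exact Or.inl h
    · exact Or.inr ⟨_, _, hjoin, hunion, h⟩

/-- Induction along the composition, with the invariant that every outside vertex sees exactly S or
nothing of A. The invariant descends to the two components; if their combination is not simple, the
rest of U is, and three simple sets make up U. -/
theorem IsComposed.isSimple {A S U : Set V} (h : IsComposed G A S) (hU : IsMinimalBad G U)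
    (hG : IsDistanceHereditary G) (hF : IsForbiddenFree G) (hAU : A ⊆ U)
    (hout : ∀ v ∈ U \ A, (∀ a ∈ A, G.Adj v a ↔ a ∈ S) ∨ ∀ a ∈ A, ¬ G.Adj v a) :
    IsSimple G A S := by
  induction h with
  | single v => exact isSimple_singleton v
  | @union A S B R hA hB hd hno ihA ihB =>
    have hSA := hA.subset
    have hRB := hB.subset
    have hA' : IsSimple G A S := by
      refine ihA (Set.subset_union_left.trans hAU) fun v hv => ?_
      by_cases hvB : v ∈ B
      · exact Or.inr fun a ha h => hno a ha v hvB h.symm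
      · refine (hout v ⟨hv.1, fun h => h.elim hv.2 hvB⟩).imp (fun h a ha => ?_)
          fun h a ha => h a (Or.inl ha)
        have : a ∉ R := fun h => absurd rfl (hd.ne_of_mem ha (hRB h))
        rw [h a (Or.inl ha)]
        simp [this]
    have hB' : IsSimple G B R := by
      refine ihB (Set.subset_union_right.trans hAU) fun v hv => ?_
      by_cases hvA : v ∈ A
      · exact Or.inr fun b hb h => hno v hvA b hb h
      · refine (hout v ⟨hv.1, fun h => h.elim hvA hv.2⟩).imp (fun h a ha => ?_)
          fun h a ha => h a (Or.inr ha)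
        have : a ∉ S := fun h => absurd rfl (hd.ne_of_mem (hSA h) ha)
        rw [h a (Or.inr ha)]
        simp [this]
    refine (hU.isSimple_or_exists_isJoin hG hF hAU (Set.union_subset_union hSA hRB)
      (hA.nonempty.mono Set.subset_union_left) hout).resolve_right ?_
    rintro ⟨C, Q, hjoin, rfl, hC⟩
    -- The two components are the leaves of a star whose centre is the outside C.
    refine hU.not_hasCCT ?_
    rw [Set.union_comm]
    exact hjoin.symm.hasCCT_star hF hC hA' hB' hd hno
  | @join A S B R hA hB hd hadj ihA ihB =>
    have hSA := hA.subset
    have hRB := hB.subset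
    have h₁₂ : IsJoin G A S B R := ⟨hd, hSA, hRB, hadj⟩
    have hA' : IsSimple G A S := by
      refine ihA (Set.subset_union_left.trans hAU) fun v hv => ?_
      by_cases hvB : v ∈ B
      · by_cases hvR : v ∈ R
        · exact Or.inl fun a ha => by rw [G.adj_comm, hadj a ha v hvB]; simp [hvR]
        · exact Or.inr fun a ha => by rw [G.adj_comm, hadj a ha v hvB]; simp [hvR]
      · refine (hout v ⟨hv.1, fun h => h.elim hv.2 hvB⟩).imp (fun h a ha => ?_)
          fun h a ha => h a (Or.inl ha)
        have : a ∉ R := fun h => absurd rfl (hd.ne_of_mem ha (hRB h))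
        rw [h a (Or.inl ha)]
        simp [this]
    have hB' : IsSimple G B R := by
      refine ihB (Set.subset_union_right.trans hAU) fun v hv => ?_
      by_cases hvA : v ∈ A
      · by_cases hvS : v ∈ S
        · exact Or.inl fun b hb => by rw [hadj v hvA b hb]; simp [hvS]
        · exact Or.inr fun b hb => by rw [hadj v hvA b hb]; simp [hvS]
      · refine (hout v ⟨hv.1, fun h => h.elim hvA hv.2⟩).imp (fun h a ha => ?_)
          fun h a ha => h a (Or.inr ha)
        have : a ∉ S := fun h => absurd rfl (hd.ne_of_mem (hSA h) ha)
        rw [h a (Or.inr ha)]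
        simp [this]
    refine (hU.isSimple_or_exists_isJoin hG hF hAU (Set.union_subset_union hSA hRB)
      (hA.nonempty.mono Set.subset_union_left) hout).resolve_right ?_
    rintro ⟨C, Q, hjoin, rfl, hC⟩
    -- Both components keep their marks, so with the outside they are pairwise joined.
    refine hU.not_hasCCT (IsJoin.hasCCT_triangle hF h₁₂ (hjoin.of_union_left hd hSA hRB) ?_
      hA' hB' hC)
    rw [Set.union_comm, Set.union_comm S] at hjoin
    exact hjoin.of_union_left hd.symm hRB hSA
  | @attach A S B R hA hB hd hadj ihA ihB =>
    have hSA := hA.subset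
    have hRB := hB.subset
    have hA' : IsSimple G A S := by
      refine ihA (Set.subset_union_left.trans hAU) fun v hv => ?_
      by_cases hvB : v ∈ B
      · by_cases hvR : v ∈ R
        · exact Or.inl fun a ha => by rw [G.adj_comm, hadj a ha v hvB]; simp [hvR]
        · exact Or.inr fun a ha => by rw [G.adj_comm, hadj a ha v hvB]; simp [hvR]
      · exact (hout v ⟨hv.1, fun h => h.elim hv.2 hvB⟩).imp (fun h a ha => h a (Or.inl ha))
          fun h a ha => h a (Or.inl ha)
    have hB' : IsSimple G B R := by
      refine ihB (Set.subset_union_right.trans hAU) fun v hv => ?_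
      by_cases hvA : v ∈ A
      · by_cases hvS : v ∈ S
        · exact Or.inl fun b hb => by rw [hadj v hvA b hb]; simp [hvS]
        · exact Or.inr fun b hb => by rw [hadj v hvA b hb]; simp [hvS]
      · refine Or.inr fun b hb hvb => ?_
        rcases hout v ⟨hv.1, fun h => h.elim hvA hv.2⟩ with h | h
        · exact absurd rfl (hd.ne_of_mem (hSA ((h b (Or.inr hb)).1 hvb)) hb)
        · exact h b (Or.inr hb) hvb
    refine (hU.isSimple_or_exists_isJoin hG hF hAU (hSA.trans Set.subset_union_left)
      hA.nonempty hout).resolve_right ?_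
    rintro ⟨C, Q, hjoin, rfl, hC⟩
    -- The vertices of B have lost their marks, so B sees nothing of C; this is a star with centre A
    -- and leaves B and C.
    have hBC : ∀ b ∈ B, ∀ c ∈ C, ¬ G.Adj b c := fun b hb c hc hbc =>
      absurd rfl (hd.ne_of_mem (hSA ((hjoin.adj_iff b (Or.inr hb) c hc).1 hbc).1) hb)
    have hdBC : Disjoint B C := hjoin.disjoint.mono_left Set.subset_union_right
    have hAB : IsJoin G B R A S := IsJoin.symm ⟨hd, hSA, hRB, hadj⟩
    have hCA : IsJoin G C Q A S := by
      refine ⟨(hjoin.disjoint.mono_left Set.subset_union_left).symm, hjoin.subset_right, hSA,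
        fun c hc a ha => ?_⟩
      rw [G.adj_comm, hjoin.adj_iff a (Or.inl ha) c hc, and_comm]
    refine hU.not_hasCCT ?_
    rw [Set.union_assoc]
    exact (hAB.union_left hCA hdBC).symm.hasCCT_star hF hA' hB' hC hdBC hBC

/-- A finite distance-hereditary graph without forbidden subgraphs has a clique
cycle-transversal. -/
theorem IsForbiddenFree.hasCCT [Finite V] (hF : IsForbiddenFree G)
    (hG : IsDistanceHereditary G) : HasCCT G Set.univ := by
  by_contra hno
  obtain ⟨U, hU⟩ := exists_minimal_of_wellFoundedLT (fun U : Set V => ¬ HasCCT G U) ⟨_, hno⟩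
  have hbad : IsMinimalBad G U :=
    ⟨hU.prop, fun W hW hne => by_contra fun h => hne (hW.antisymm (hU.le_of_le h hW))⟩
  have hne : U.Nonempty := by
    by_contra hemp
    rw [Set.not_nonempty_iff_eq_empty] at hemp
    subst hemp
    exact hU.prop ⟨∅, subset_rfl, by simp, isThin_of_independent (by simp)⟩
  obtain ⟨S, hS⟩ := hG.exists_isComposed hne
  -- For the whole set U there are no outside vertices, so the invariant holds vacuously.
  have hsimple := hS.isSimple hbad hG hF subset_rfl fun v hv => absurd hv.1 hv.2
  obtain ⟨T, hT, hc⟩ := hsimple.exists_transversal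
  exact hU.prop ⟨T, hT.trans hsimple.subset, hc⟩

end CliqueCycleTransversal

theorem theorem2 {V : Type*} [Finite V] (G : SimpleGraph V)
    (hG : CliqueCycleTransversal.IsDistanceHereditary G) :
    (CliqueCycleTransversal.AdmitsCCT G ↔ CliqueCycleTransversal.IsForbiddenFree G) ∧
    (CliqueCycleTransversal.AdmitsCCT G ↔
      CliqueCycleTransversal.SplitsIntoCliqueAndForest G) :=
  ⟨⟨fun h => CliqueCycleTransversal.isForbiddenFree_of_hasCCT (hG.admitsCCT_iff.1 h),
    fun hF => hG.admitsCCT_iff.2 (hF.hasCCT hG)⟩,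
    CliqueCycleTransversal.admitsCCT_iff_splitsIntoCliqueAndForest⟩
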